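/- Let $V$ be a complex vector space of dimension $n\ge 5$ with basis $e_1,\dots,e_n$, and write products in the exterior algebra without $\wedge$. Let $X=\operatorname{Gr}(3,V)\subset\mathbb P(\bigwedge^3V)$ in its Plücker embedding. Let $\sigma_2(X)$ be its chordal (secant) variety, i.e. the Zariski closure of the union of the spans of pairs of points of $X$, and let $\sigma_2^1(X)$ be the Zariski closure of the set of points $[\lambda_1\widehat E_1+\lambda_2\widehat E_2]$ with $E_1,E_2\subset V$ of dimension $3$ and $\dim(E_1\cap E_2)\ge 1$, where $\widehat E$ is a nonzero vector on the Plücker line of $E$. For a projective variety $Y$ and a point $x$ of its affine cone, $\widehat T_xY$ denotes the set of velocities $\gamma'(0)$ of holomorphic curve germs $\gamma$ in the affine cone over $Y$ with $\gamma(0)=x$. For a set $S\subset\bigwedge^2V$ let $V\cdot S$ be the span of all products $vw$ with $v\in V$, $w\in S$. Put $\widehat T_{ijk}=\widehat T_{e_ie_je_k}X$ and $D=\operatorname{span}\{e_ie_2e_3-e_ie_4e_5\mid 6\le i\le n\}$. Then: 1. $\widehat T_{e_1e_2e_3+e_1e_4e_5}\,\sigma_2^1(X)=V\cdot\{e_2e_3+e_4e_5,\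 e_1e_2,\ e_1e_3,\ e_1e_4,\ e_1e_5\}$. 2. $\widehat T_{123}=V\cdot\{e_1e_2,e_1e_3,e_2e_3\}$ and $\widehat T_{145}=V\cdot\{e_1e_4,e_1e_5,e_4e_5\}$. The space $\widehat T_{123}\cap\widehat T_{145}$ has basis $e_1e_2e_4,\ e_1e_2e_5,\ e_1e_3e_4,\ e_1e_3e_5$. One has $\dim D=n-5$ and $$\widehat T_{123}+\widehat T_{145}=\widehat T_{e_1e_2e_3+e_1e_4e_5}\,\sigma_2^1(X)\oplus D .$$ If $n\ge 6$, then moreover $$\widehat T_{e_1e_2e_3+e_4e_5e_6}\,\sigma_2(X)=\widehat T_{123}\oplus\widehat T_{456}=V\cdot\{e_1e_2,e_1e_3,e_2e_3,e_4e_5,e_4e_6,e_5e_6\},$$ and there is an isomorphism of vector spaces $$\widehat T_{e_1e_2e_3+e_4e_5e_6}\,\sigma_2(X)\;\cong\;\widehat T_{e_1e_2e_3+e_1e_4e_5}\,\sigma_2^1(X)\,\oplus\, D\,\oplus\,\bigl(\widehat T_{123}\cap\widehat T_{145}\bigr).$$ 3. $\dim\sigma_2^1(X)=5n-16$. If $n\ge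 6$, then $\sigma_2^1(X)$ is contained in $\sigma_2(X)$ with codimension $n-1$; if $n=5$, then $\sigma_2^1(X)=\sigma_2(X)$. -/

import Mathlib

open scoped LinearAlgebra.Projectivization Topology Pointwise

noncomputable section

namespace RestrictedSecant

/-! ## Projective geometry in `ℙ W` for a finite-dimensional complex vector space `W` -/

section Projective

variable {W : Type*} [AddCommGroup W] [Module ℂ W]

/-- The value at `w` of a polynomial in the linear forms on `W`.  Every polynomial function on a
finite-dimensional `W` arises in this way, without a choice of coordinates, and the homogeneous
polynomial functions of degree `d` come from the homogeneous `F` of degree `d`. -/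
def evalAt (F : MvPolynomial (Module.Dual ℂ W) ℂ) (w : W) : ℂ :=
  MvPolynomial.eval (fun φ : Module.Dual ℂ W => φ w) F

/-- The Zariski closure of `S ⊆ ℙ W`: the common zeros of all homogeneous polynomials that
vanish on `S`. -/
def zariskiClosure (S : Set (ℙ ℂ W)) : Set (ℙ ℂ W) :=
  {p | ∀ (d : ℕ) (F : MvPolynomial (Module.Dual ℂ W) ℂ), F.IsHomogeneous d →
    (∀ q ∈ S, evalAt F q.rep = 0) → evalAt F p.rep = 0}

/-- The affine cone in `W` over `X ⊆ ℙ W` (with its vertex `0`). -/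
def cone (X : Set (ℙ ℂ W)) : Set W :=
  {w | ∀ hw : w ≠ 0, Projectivization.mk ℂ w hw ∈ X}

/-- The ideal of all polynomials that vanish on the affine cone over `X`. -/
def vanishingIdeal (X : Set (ℙ ℂ W)) : Ideal (MvPolynomial (Module.Dual ℂ W) ℂ) where
  carrier := {F | ∀ w ∈ cone X, evalAt F w = 0}
  add_mem' := by
    intro F G hF hG w hw
    have h1 := hF w hw
    have h2 := hG w hw
    simp only [evalAt] at h1 h2 ⊢
    rw [map_add, h1, h2, add_zero]
  zero_mem' := by
    intro w _
    simp [evalAt]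
  smul_mem' := by
    intro G F hF w hw
    have h1 := hF w hw
    simp only [evalAt] at h1 ⊢
    rw [smul_eq_mul, map_mul, h1, mul_zero]

/-- The homogeneous coordinate ring of `X ⊆ ℙ W`. -/
abbrev CoordinateRing (X : Set (ℙ ℂ W)) : Type _ :=
  MvPolynomial (Module.Dual ℂ W) ℂ ⧸ vanishingIdeal X

/-- The projective variety `X` has dimension `d`: its homogeneous coordinate ring (the coordinate
ring of the affine cone over `X`) has Krull dimension `d + 1`. -/
def HasDim (X : Set (ℙ ℂ W)) (d : ℕ) : Prop :=
  ringKrullDim (CoordinateRing X) = ((d + 1 : ℕ) : WithBot ℕ∞)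

/-- `Y` is contained in `X` with codimension `c`, that is `dim X = dim Y + c`. -/
def HasCodimIn (Y X : Set (ℙ ℂ W)) (c : ℕ) : Prop :=
  Y ⊆ X ∧ ∃ d : ℕ, HasDim Y d ∧ HasDim X (d + c)

/-- The `s`-secant variety of `X ⊆ ℙ W`: the Zariski closure of the set of points that lie in the
span of `s` points of `X`. -/
def secantVariety (s : ℕ) (X : Set (ℙ ℂ W)) : Set (ℙ ℂ W) :=
  zariskiClosure {p | ∃ x : Fin s → ℙ ℂ W, (∀ i, x i ∈ X) ∧
    p.submodule ≤ ⨆ i, (x i).submodule}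

/-- The cone over the tangent space of `X` at (the class of) `x`: the set of all velocities
`γ'(0)` of holomorphic curve germs `γ` in the affine cone over `X` with `γ(0) = x`.
A map into the finite-dimensional space `W` is holomorphic with derivative `v` at `0` when
this holds after composition with every linear form. -/
def coneTangentSpace (X : Set (ℙ ℂ W)) (x : W) : Set W :=
  {v | ∃ γ : ℂ → W, γ 0 = x ∧ (∀ᶠ t in 𝓝 (0 : ℂ), γ t ∈ cone X) ∧
    ∀ φ : Module.Dual ℂ W,
      AnalyticAt ℂ (fun t => φ (γ t)) 0 ∧ HasDerivAt (fun t => φ (γ t)) (φ v) 0}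

end Projective

/-! ## Grassmannians and their restricted secant varieties -/

section Grassmannian

variable {V : Type*} [AddCommGroup V] [Module ℂ V]

/-- The line in `⋀^k V` that the Plücker embedding attaches to a `k`-plane `E`: it is spanned by
`v₁ ∧ ⋯ ∧ v_k` for any basis `v₁, …, v_k` of `E`. -/
def pluckerLine (k : ℕ) (E : Submodule ℂ V) : Submodule ℂ (⋀[ℂ]^k V) :=
  LinearMap.range (exteriorPower.map k E.subtype)

variable (V) in
/-- The Grassmannian `Gr(k, V)` in its Plücker embedding into `ℙ (⋀^k V)`. -/
def grassmannian (k : ℕ) : Set (ℙ ℂ (⋀[ℂ]^k V)) :=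
  {p | ∃ E : Submodule ℂ V, Module.finrank ℂ E = k ∧ p.submodule = pluckerLine k E}

variable (V) in
/-- The `r`-restricted `s`-secant variety of `Gr(k, V)`: the Zariski closure of the set of all
points `[λ₁ Ê₁ + ⋯ + λ_s Ê_s]` with `k`-planes `E₁, …, E_s` in `V` such that
`dim (E₁ ∩ ⋯ ∩ E_s) ≥ r`. -/
def restrictedSecant (s r k : ℕ) : Set (ℙ ℂ (⋀[ℂ]^k V)) :=
  zariskiClosure {p | ∃ E : Fin s → Submodule ℂ V, (∀ i, Module.finrank ℂ (E i) = k) ∧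
    r ≤ Module.finrank ℂ (⨅ i, E i : Submodule ℂ V) ∧
    p.submodule ≤ ⨆ i, pluckerLine k (E i)}

/-- `V · S`: the span in `⋀^(k+1) V` of all products `v ∧ w` with `v ∈ V` and `w ∈ S`. -/
def dot {k : ℕ} (S : Set (⋀[ℂ]^k V)) : Submodule ℂ (⋀[ℂ]^(k + 1) V) :=
  Submodule.span ℂ {x | ∃ v : V, ∃ w ∈ S,
    (x : ExteriorAlgebra ℂ V) = ExteriorAlgebra.ι ℂ v * (w : ExteriorAlgebra ℂ V)}

variable {n : ℕ}

/-- The vectors `e₁, …, e_n` of a basis, numbered from `1` (and `0` for any other index, which is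
never used). -/
def vec (e : Module.Basis (Fin n) ℂ V) (i : ℕ) : V :=
  if h : 1 ≤ i ∧ i ≤ n then e ⟨i - 1, by omega⟩ else 0

/-- `e_i ∧ e_j`. -/
def e2 (e : Module.Basis (Fin n) ℂ V) (i j : ℕ) : ⋀[ℂ]^2 V :=
  exteriorPower.ιMulti ℂ 2 ![vec e i, vec e j]

/-- `e_i ∧ e_j ∧ e_k`. -/
def e3 (e : Module.Basis (Fin n) ℂ V) (i j k : ℕ) : ⋀[ℂ]^3 V :=
  exteriorPower.ιMulti ℂ 3 ![vec e i, vec e j, vec e k]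

/-- The span of the vectors `e_i e_2 e_3 - e_i e_4 e_5` with `6 ≤ i ≤ n`. -/
def extraSpan (e : Module.Basis (Fin n) ℂ V) : Submodule ℂ (⋀[ℂ]^3 V) :=
  Submodule.span ℂ {x | ∃ i : ℕ, 6 ≤ i ∧ i ≤ n ∧ x = e3 e i 2 3 - e3 e i 4 5}

end Grassmannian

end RestrictedSecant

end

/-!
In each of the three cases the cone in question (before Zariski closure) consists of the images
`⋀³g ξ` of one model trivector `ξ ∈ ⋀³U` under all linear maps `g : U → V`, where `ξ` is
`x₁x₂x₃` on `ℂ³`, `x₁x₂x₃ + x₁x₄x₅` on `ℂ⁵` and `x₁x₂x₃ + x₄x₅x₆` on `ℂ⁶` respectively.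

Moving one basis vector of `U` moves `⋀³g₀ ξ` along a line in the cone, and the directions of these
lines span the space `T = V · S` of the theorem. Applying `⋀³` of endomorphisms of `V` along curves
shows that the span of such directions, even together with one further tangent vector of the
closure, still consists of tangent vectors. On the other hand every general `g` has, after a change
of coordinates in `U`, the form `g₀ + N` with `N` mapping into a fixed complement `K` of the range
of `g₀`, so that `(y, N) ↦ ⋀³(g₀ + N) y` on `⋀³U × Hom(U, K)` dominates the cone. Its source has
dimension `C(m, 3) + m (n - m)` with `m = dim U`, which bounds the dimension of every linear space
of tangent vectors. Once `dim T` reaches this bound, `T` is the whole tangent space and `dim T` is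
the dimension of the cone.

For `Gr(3, V)` the bound is reached by exhibiting `⋀³A ⊕ (⋀²A ⊗ K)` inside `T`. This
gives `dim T̂₁₂₃ = dim T̂₁₄₅ = 3n - 8`, and as their intersection has dimension `4` their sum has
dimension `6n - 20`. This sum equals `T + D`, where `T` is the space for `x₁x₂x₃ + x₁x₄x₅`; as
`dim T ≤ 5n - 15` by the bound and `dim D ≤ n - 5`, both are equalities and the sum is direct.
-/

noncomputable section

namespace RestrictedSecant

/-! ## Krull dimension and transcendence degree -/

theorem ringKrullDim_eq_of_isIntegral (R S : Type*) [CommRing R] [CommRing S] [Algebra R S]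
    [FaithfulSMul R S] [Algebra.IsIntegral R S] : ringKrullDim S = ringKrullDim R := by
  apply le_antisymm
  · exact Order.krullDim_le_of_strictMono
      (fun I ↦ (⟨Ideal.comap (algebraMap R S) I.asIdeal, inferInstance⟩ : PrimeSpectrum R))
      fun I J hIJ ↦ Ideal.IsIntegral.comap_lt_comap (I := I.asIdeal) (J := J.asIdeal) hIJ
  · refine iSup_le fun l ↦ ?_
    have hker : (⊥ : Ideal S).comap (algebraMap R S) = ⊥ :=
      (RingHom.injective_iff_ker_eq_bot _).mp (FaithfulSMul.algebraMap_injective R S)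
    obtain ⟨P, -, hP, hPl⟩ := Ideal.exists_ideal_over_prime_of_isIntegral (S := S)
      l.head.asIdeal ⊥ (hker.trans_le bot_le)
    have : P.LiesOver l.head.asIdeal := ⟨hPl.symm⟩
    obtain ⟨L, hL, -⟩ := Ideal.exists_ltSeries_of_hasGoingUp l P
    rw [← hL]
    exact le_iSup (fun p : LTSeries (PrimeSpectrum S) ↦ ((p.length : ℕ∞) : WithBot ℕ∞)) L

/-- By Noether normalization. -/
theorem ringKrullDim_eq_of_trdeg_eq {k A : Type*} [Field k] [CommRing A] [IsDomain A] [Algebra k A]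
    [Algebra.FiniteType k A] {n : ℕ} (h : Algebra.trdeg k A = n) : ringKrullDim A = n := by
  obtain ⟨s, g, hg, hint⟩ := exists_integral_inj_algHom_of_fg k A
  let _ := g.toRingHom.toAlgebra
  have : IsScalarTower k (MvPolynomial (Fin s) k) A :=
    IsScalarTower.of_algebraMap_eq fun x ↦ (g.commutes x).symm
  have : Algebra.IsIntegral (MvPolynomial (Fin s) k) A := ⟨hint⟩
  have : FaithfulSMul (MvPolynomial (Fin s) k) A :=
    (faithfulSMul_iff_algebraMap_injective _ _).mpr hg
  have hs : (s : Cardinal.{0}) = n := by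
    simpa [trdeg_eq_zero, MvPolynomial.trdeg_of_isDomain, h] using
      lift_trdeg_add_eq k (MvPolynomial (Fin s) k) A
  rw [ringKrullDim_eq_of_isIntegral (MvPolynomial (Fin s) k) A,
    MvPolynomial.ringKrullDim_of_isNoetherianRing, ringKrullDim_eq_zero_of_field]
  simpa using mod_cast hs

/-! ## Cones and Zariski closures -/

theorem eval_smul_of_isHomogeneous {σ R : Type*} [CommSemiring R] {F : MvPolynomial σ R} {d : ℕ}
    (hF : F.IsHomogeneous d) (c : R) (x : σ → R) :
    MvPolynomial.eval (c • x) F = c ^ d * MvPolynomial.eval x F := by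
  rw [MvPolynomial.eval_eq, MvPolynomial.eval_eq, Finset.mul_sum]
  refine Finset.sum_congr rfl fun m hm ↦ ?_
  have hdeg : ∑ i ∈ m.support, m i = d := by
    simpa [Finsupp.weight_apply, Finsupp.sum] using hF (MvPolynomial.mem_support_iff.mp hm)
  simp only [Pi.smul_apply, smul_eq_mul, mul_pow, Finset.prod_mul_distrib,
    Finset.prod_pow_eq_pow_sum, hdeg]
  ring

section Cone

variable {W : Type*} [AddCommGroup W] [Module ℂ W] {S X Y : Set (ℙ ℂ W)} {w : W}

theorem evalAt_smul {F : MvPolynomial (Module.Dual ℂ W) ℂ} {d : ℕ} (hF : F.IsHomogeneous d)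
    (c : ℂ) (w : W) : evalAt F (c • w) = c ^ d * evalAt F w := by
  rw [evalAt, evalAt, ← eval_smul_of_isHomogeneous hF]
  simp only [map_smul]
  rfl

theorem evalAt_mk_rep_eq_zero_iff {F : MvPolynomial (Module.Dual ℂ W) ℂ} {d : ℕ}
    (hF : F.IsHomogeneous d) (hw : w ≠ 0) :
    evalAt F (Projectivization.mk ℂ w hw).rep = 0 ↔ evalAt F w = 0 := by
  obtain ⟨a, ha⟩ := Projectivization.exists_smul_eq_mk_rep ℂ w hw
  rw [← ha, Units.smul_def, evalAt_smul hF, mul_eq_zero, or_iff_right (pow_ne_zero d a.ne_zero)]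

theorem evalAt_eq_sum_homogeneousComponent (F : MvPolynomial (Module.Dual ℂ W) ℂ) (w : W) :
    evalAt F w = ∑ i ∈ Finset.range (F.totalDegree + 1),
      evalAt (MvPolynomial.homogeneousComponent i F) w := by
  conv_lhs => rw [← MvPolynomial.sum_homogeneousComponent F]
  exact map_sum (MvPolynomial.eval _) _ _

theorem evalAt_homogeneousComponent_eq_zero {F : MvPolynomial (Module.Dual ℂ W) ℂ}
    (h : ∀ c : ℂ, evalAt F (c • w) = 0) (i : ℕ) :
    evalAt (MvPolynomial.homogeneousComponent i F) w = 0 := by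
  by_cases hi : i < F.totalDegree + 1
  swap
  · rw [MvPolynomial.homogeneousComponent_eq_zero i F (by lia)]
    exact map_zero _
  let q : Polynomial ℂ := ∑ j ∈ Finset.range (F.totalDegree + 1),
    Polynomial.monomial j (evalAt (MvPolynomial.homogeneousComponent j F) w)
  have hq : q = 0 := by
    refine Polynomial.funext fun c ↦ ?_
    rw [Polynomial.eval_zero, ← h c, evalAt_eq_sum_homogeneousComponent, Polynomial.eval_finsetSum]
    refine Finset.sum_congr rfl fun j _ ↦ ?_
    rw [Polynomial.eval_monomial, mul_comm,
      evalAt_smul (MvPolynomial.homogeneousComponent_isHomogeneous j F)]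
  have hcoeff : q.coeff i = evalAt (MvPolynomial.homogeneousComponent i F) w := by
    simp only [q, Polynomial.finsetSum_coeff, Polynomial.coeff_monomial, Finset.sum_ite_eq',
      Finset.mem_range, if_pos hi]
  rw [← hcoeff, hq, Polynomial.coeff_zero]

theorem smul_mem_cone (h : w ∈ cone X) (c : ℂ) : c • w ∈ cone X := by
  intro hcw
  have hw : w ≠ 0 := (smul_ne_zero_iff.mp hcw).2
  rw [(Projectivization.mk_eq_mk_iff' ℂ _ _ hcw hw).mpr ⟨c, rfl⟩]
  exact h hw

theorem rep_mem_cone {p : ℙ ℂ W} (hp : p ∈ X) : p.rep ∈ cone X := fun _ ↦ by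
  rwa [Projectivization.mk_rep]

theorem zero_mem_cone (X : Set (ℙ ℂ W)) : (0 : W) ∈ cone X := fun h ↦ (h rfl).elim

theorem cone_mono (h : X ⊆ Y) : cone X ⊆ cone Y := fun _ hw h0 ↦ h (hw h0)

theorem subset_of_cone_subset (h : cone X ⊆ cone Y) : X ⊆ Y := fun p hp ↦ by
  simpa only [Projectivization.mk_rep] using h (rep_mem_cone hp) p.rep_nonzero

theorem subset_zariskiClosure (S : Set (ℙ ℂ W)) : S ⊆ zariskiClosure S :=
  fun p hp _ _ _ h ↦ h p hp

theorem zariskiClosure_mono (h : X ⊆ Y) : zariskiClosure X ⊆ zariskiClosure Y :=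
  fun _ hp d F hF hY ↦ hp d F hF fun q hq ↦ hY q (h hq)

theorem evalAt_eq_zero_of_mem_cone_zariskiClosure {F : MvPolynomial (Module.Dual ℂ W) ℂ}
    (hF : ∀ u ∈ cone S, evalAt F u = 0) (hw : w ∈ cone (zariskiClosure S)) : evalAt F w = 0 := by
  by_cases hw0 : w = 0
  · exact hw0 ▸ hF 0 (zero_mem_cone S)
  rw [evalAt_eq_sum_homogeneousComponent]
  refine Finset.sum_eq_zero fun i _ ↦ ?_
  have hi := MvPolynomial.homogeneousComponent_isHomogeneous i F
  exact (evalAt_mk_rep_eq_zero_iff hi hw0).mp <| hw hw0 i _ hi fun q hq ↦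
    evalAt_homogeneousComponent_eq_zero (fun c ↦ hF _ (smul_mem_cone (rep_mem_cone hq) c)) i

theorem mem_cone_zariskiClosure_iff :
    w ∈ cone (zariskiClosure S) ↔
      ∀ F : MvPolynomial (Module.Dual ℂ W) ℂ, (∀ u ∈ cone S, evalAt F u = 0) → evalAt F w = 0 := by
  refine ⟨fun hw F hF ↦ evalAt_eq_zero_of_mem_cone_zariskiClosure hF hw, fun h hw0 d F hF hS ↦ ?_⟩
  obtain ⟨φ, hφ⟩ := Module.Projective.exists_dual_ne_zero ℂ hw0
  -- `F` may be a nonzero constant, hence not vanish at the vertex of `cone S`; `F * φ` does.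
  have hFφ : evalAt (F * MvPolynomial.X φ) w = 0 := by
    refine h _ fun u hu ↦ ?_
    rw [evalAt, map_mul, MvPolynomial.eval_X]
    by_cases hu0 : u = 0
    · rw [hu0, map_zero, mul_zero]
    · rw [← evalAt, (evalAt_mk_rep_eq_zero_iff hF hu0).mp (hS _ (hu hu0)), zero_mul]
  rw [evalAt, map_mul, MvPolynomial.eval_X, mul_eq_zero, or_iff_left hφ] at hFφ
  exact (evalAt_mk_rep_eq_zero_iff hF hw0).mpr hFφ

theorem mem_vanishingIdeal_zariskiClosure {F : MvPolynomial (Module.Dual ℂ W) ℂ} :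
    F ∈ vanishingIdeal (zariskiClosure S) ↔ ∀ w ∈ cone S, evalAt F w = 0 :=
  ⟨fun h w hw ↦ h w (cone_mono (subset_zariskiClosure S) hw),
    fun h _ hw ↦ evalAt_eq_zero_of_mem_cone_zariskiClosure h hw⟩

theorem evalAt_rename_dualMap {W' : Type*} [AddCommGroup W'] [Module ℂ W'] (L : W →ₗ[ℂ] W')
    (F : MvPolynomial (Module.Dual ℂ W') ℂ) (w : W) :
    evalAt (MvPolynomial.rename L.dualMap F) w = evalAt F (L w) := by
  rw [evalAt, MvPolynomial.eval_rename]
  rfl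

theorem map_mem_cone_zariskiClosure {L : W →ₗ[ℂ] W} (hL : ∀ u ∈ cone S, L u ∈ cone S)
    (hw : w ∈ cone (zariskiClosure S)) : L w ∈ cone (zariskiClosure S) := by
  rw [mem_cone_zariskiClosure_iff] at hw ⊢
  intro F hF
  rw [← evalAt_rename_dualMap]
  exact hw _ fun u hu ↦ (evalAt_rename_dualMap L F u).trans (hF _ (hL u hu))

end Cone

/-! ## Tangent spaces and dimension -/

section Tangent

open Filter

/-- The lowest homogeneous component of `P`, with the higher ones as a continuous perturbation. -/
theorem exists_eval_smul_eq_pow_mul {σ : Type*} {P : MvPolynomial σ ℂ} (hP : P ≠ 0) :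
    ∃ (d : ℕ) (R : ℂ × (σ → ℂ) → ℂ), Continuous R ∧ (∃ y, R (0, y) ≠ 0) ∧
      ∀ (t : ℂ) (y : σ → ℂ), MvPolynomial.eval (t • y) P = t ^ d * R (t, y) := by
  classical
  have hex : ∃ d, MvPolynomial.homogeneousComponent d P ≠ 0 := by
    by_contra! hall
    rw [← MvPolynomial.sum_homogeneousComponent P] at hP
    exact hP (Finset.sum_eq_zero fun i _ ↦ hall i)
  let d := Nat.find hex
  let R : ℂ × (σ → ℂ) → ℂ := fun z ↦ ∑ i ∈ Finset.range (P.totalDegree + 1),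
    z.1 ^ (i - d) * MvPolynomial.eval z.2 (MvPolynomial.homogeneousComponent i P)
  have hlow : ∀ i < d, MvPolynomial.homogeneousComponent i P = 0 := fun i hi ↦
    not_not.mp (Nat.find_min hex hi)
  have hd : d ∈ Finset.range (P.totalDegree + 1) := by
    by_contra hd
    exact Nat.find_spec hex (MvPolynomial.homogeneousComponent_eq_zero _ _ (by grind))
  refine ⟨d, R, ?_, ?_, fun t y ↦ ?_⟩
  · have := fun Q : MvPolynomial σ ℂ ↦ MvPolynomial.continuous_eval Q
    fun_prop
  · have hlead : ∀ y, R (0, y) = MvPolynomial.eval y (MvPolynomial.homogeneousComponent d P) := by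
      intro y
      refine (Finset.sum_eq_single_of_mem d hd fun i _ hi ↦ ?_).trans (by simp)
      rcases hi.lt_or_gt with hi | hi
      · rw [hlow i hi, map_zero, mul_zero]
      · rw [zero_pow (by lia), zero_mul]
    by_contra! hR
    exact Nat.find_spec hex (MvPolynomial.funext fun y ↦ by rw [← hlead, hR, map_zero])
  · conv_lhs => rw [← MvPolynomial.sum_homogeneousComponent P, map_sum]
    rw [Finset.mul_sum]
    refine Finset.sum_congr rfl fun i _ ↦ ?_
    rw [eval_smul_of_isHomogeneous (MvPolynomial.homogeneousComponent_isHomogeneous i P)]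
    rcases lt_or_ge i d with hi | hi
    · rw [hlow i hi, map_zero, mul_zero, mul_zero, mul_zero]
    · rw [← mul_assoc, ← pow_add, Nat.add_sub_cancel' hi]

theorem eq_zero_of_eventually_eval_curve_eq_zero {σ : Type*} {P : MvPolynomial σ ℂ}
    (h : ∀ y : σ → ℂ, ∃ g : ℂ → σ → ℂ, g 0 = 0 ∧ (∀ i, HasDerivAt (fun t ↦ g t i) (y i) 0) ∧
      ∀ᶠ t in 𝓝 (0 : ℂ), MvPolynomial.eval (g t) P = 0) : P = 0 := by
  by_contra hP
  obtain ⟨d, R, hR, ⟨y, hy⟩, hPR⟩ := exists_eval_smul_eq_pow_mul hP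
  obtain ⟨g, hg0, hgy, hgP⟩ := h y
  have hslope : Tendsto (fun t : ℂ ↦ t⁻¹ • g t) (𝓝[≠] 0) (𝓝 y) :=
    tendsto_pi_nhds.mpr fun i ↦ by simpa [hg0] using hasDerivAt_iff_tendsto_slope_zero.mp (hgy i)
  have hlim : Tendsto (fun t : ℂ ↦ R (t, t⁻¹ • g t)) (𝓝[≠] 0) (𝓝 (R (0, y))) :=
    (hR.tendsto (0, y)).comp ((tendsto_id.mono_left nhdsWithin_le_nhds).prodMk_nhds hslope)
  refine hy (tendsto_nhds_unique hlim (tendsto_const_nhds.congr' ?_))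
  filter_upwards [hgP.filter_mono nhdsWithin_le_nhds, self_mem_nhdsWithin] with t ht ht0
  rw [← smul_inv_smul₀ ht0 (g t), hPR] at ht
  exact ((mul_eq_zero.mp ht).resolve_left (pow_ne_zero d ht0)).symm

variable {W : Type*} [AddCommGroup W] [Module ℂ W] {S X Y : Set (ℙ ℂ W)} {x v τ : W}

theorem aeval_mk_eq_zero_iff {ι : Type*} (f : ι → MvPolynomial (Module.Dual ℂ W) ℂ)
    (P : MvPolynomial ι ℂ) :
    MvPolynomial.aeval (fun i ↦ (Ideal.Quotient.mk (vanishingIdeal X) (f i) : CoordinateRing X)) P =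
      0 ↔ ∀ w ∈ cone X, MvPolynomial.eval (fun i ↦ evalAt (f i) w) P = 0 := by
  have hmk : MvPolynomial.aeval (fun i ↦ (Ideal.Quotient.mk (vanishingIdeal X) (f i) :
      CoordinateRing X)) P = Ideal.Quotient.mk (vanishingIdeal X) (MvPolynomial.bind₁ f P) :=
    (MvPolynomial.comp_aeval_apply f (Ideal.Quotient.mkₐ ℂ (vanishingIdeal X)) P).symm
  rw [hmk, Ideal.Quotient.eq_zero_iff_mem]
  refine forall₂_congr fun w _ ↦ ?_
  simp only [evalAt, MvPolynomial.eval, MvPolynomial.eval₂Hom_bind₁]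

instance finiteType_coordinateRing [FiniteDimensional ℂ W] (X : Set (ℙ ℂ W)) :
    Algebra.FiniteType ℂ (CoordinateRing X) := by
  let b := Module.finBasis ℂ (Module.Dual ℂ W)
  let f : MvPolynomial (Fin (Module.finrank ℂ (Module.Dual ℂ W))) ℂ →ₐ[ℂ] CoordinateRing X :=
    MvPolynomial.aeval fun i ↦ Ideal.Quotient.mk _ (MvPolynomial.X (b i))
  let G : Module.Dual ℂ W → MvPolynomial (Fin (Module.finrank ℂ (Module.Dual ℂ W))) ℂ :=
    fun φ ↦ ∑ i, MvPolynomial.C (b.repr φ i) * MvPolynomial.X i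
  have hfG : f.comp (MvPolynomial.bind₁ G) = Ideal.Quotient.mkₐ ℂ (vanishingIdeal X) := by
    refine MvPolynomial.algHom_ext fun φ ↦ ?_
    have hφ : f (G φ) = Ideal.Quotient.mk _
        (∑ i, MvPolynomial.C (b.repr φ i) * MvPolynomial.X (b i)) := by
      simp only [G, f, map_sum, map_mul, MvPolynomial.aeval_X, MvPolynomial.algHom_C]
      rfl
    rw [AlgHom.comp_apply, MvPolynomial.bind₁_X_right, hφ]
    refine Ideal.Quotient.eq.mpr fun w _ ↦ ?_
    have hφw : φ w = ∑ i, b.repr φ i * b i w := by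
      conv_lhs => rw [← b.sum_repr φ]
      simp only [LinearMap.sum_apply, LinearMap.smul_apply, smul_eq_mul]
    simp only [evalAt, map_sub, map_sum, map_mul, MvPolynomial.eval_C, MvPolynomial.eval_X, hφw,
      sub_self]
  refine Algebra.FiniteType.of_surjective f fun y ↦ ?_
  obtain ⟨F, rfl⟩ := Ideal.Quotient.mk_surjective y
  exact ⟨MvPolynomial.bind₁ G F, DFunLike.congr_fun hfG F⟩

theorem finrank_le_trdeg_coordinateRing [FiniteDimensional ℂ W] {T : Submodule ℂ W}
    (hT : (T : Set W) ⊆ coneTangentSpace X x) :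
    (Module.finrank ℂ T : Cardinal) ≤ Algebra.trdeg ℂ (CoordinateRing X) := by
  let b := Module.finBasis ℂ T
  choose z hz using fun i ↦ LinearMap.exists_extend (b.coord i)
  have hind : AlgebraicIndependent ℂ (fun i ↦ (Ideal.Quotient.mk (vanishingIdeal X)
      (MvPolynomial.X (z i) - MvPolynomial.C (z i x)) : CoordinateRing X)) := by
    rw [algebraicIndependent_iff]
    intro P hP
    rw [aeval_mk_eq_zero_iff] at hP
    refine eq_zero_of_eventually_eval_curve_eq_zero fun y ↦ ?_
    obtain ⟨γ, h0, hγX, hγ⟩ := hT (b.equivFun.symm y).2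
    refine ⟨fun t i ↦ evalAt (MvPolynomial.X (z i) - MvPolynomial.C (z i x)) (γ t), ?_, ?_,
      hγX.mono fun t ht ↦ hP _ ht⟩
    · ext i
      simp [evalAt, h0]
    · intro i
      have hzi : z i (b.equivFun.symm y) = y i := by
        rw [← Submodule.subtype_apply, ← LinearMap.comp_apply, hz, Module.Basis.coord_apply,
          ← b.equivFun_apply, LinearEquiv.apply_symm_apply]
      have hγi := (hγ (z i)).2.sub_const (z i x)
      rw [hzi] at hγi
      simpa only [evalAt, map_sub, MvPolynomial.eval_X, MvPolynomial.eval_C] using hγi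
  simpa using hind.lift_cardinalMk_le_trdeg

theorem coneTangentSpace_mono (h : X ⊆ Y) (x : W) : coneTangentSpace X x ⊆ coneTangentSpace Y x :=
  fun _ ⟨γ, h0, hX, hγ⟩ ↦ ⟨γ, h0, hX.mono fun _ ht ↦ cone_mono h ht, hγ⟩

theorem zero_mem_coneTangentSpace (hx : x ∈ cone X) : 0 ∈ coneTangentSpace X x :=
  ⟨fun _ ↦ x, rfl, Eventually.of_forall fun _ ↦ hx, fun φ ↦
    ⟨analyticAt_const, by simpa only [map_zero] using hasDerivAt_const (0 : ℂ) (φ x)⟩⟩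

theorem smul_mem_coneTangentSpace (hv : v ∈ coneTangentSpace X x) (c : ℂ) :
    c • v ∈ coneTangentSpace X x := by
  obtain ⟨γ, h0, hX, hγ⟩ := hv
  have hc : Tendsto (fun t : ℂ ↦ c * t) (𝓝 0) (𝓝 (c * 0)) := (continuous_const_mul c).tendsto 0
  rw [← mul_zero c] at hX hγ
  refine ⟨fun t ↦ γ (c * t), by simpa using h0, hc.eventually hX, fun φ ↦ ⟨?_, ?_⟩⟩
  · have hcomp : AnalyticAt ℂ ((fun t ↦ φ (γ t)) ∘ fun t ↦ c * t) 0 :=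
      (hγ φ).1.comp (f := fun t ↦ c * t) (by fun_prop)
    exact hcomp
  · have hcomp : HasDerivAt ((fun t ↦ φ (γ t)) ∘ fun t ↦ c * t) (φ v * (c * 1)) 0 :=
      (hγ φ).2.comp 0 ((hasDerivAt_id (0 : ℂ)).const_mul c)
    rwa [mul_one, mul_comm, ← smul_eq_mul, ← map_smul] at hcomp

/-- The velocity of `t ↦ L t (γ t)`, where `γ` has velocity `v` at `x`. -/
theorem add_mem_coneTangentSpace [FiniteDimensional ℂ W] (L : ℂ → W →ₗ[ℂ] W) (hL0 : L 0 = .id)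
    (hLX : ∀ t, ∀ w ∈ cone X, L t w ∈ cone X)
    (hL : ∀ (φ : Module.Dual ℂ W) (w : W), AnalyticAt ℂ (fun t ↦ φ (L t w)) 0)
    (hLx : ∀ t, L t x = x + t • τ) (hv : v ∈ coneTangentSpace X x) :
    v + τ ∈ coneTangentSpace X x := by
  obtain ⟨γ, h0, hX, hγ⟩ := hv
  let b := Module.finBasis ℂ W
  have hexpand (φ : Module.Dual ℂ W) : (fun t ↦ φ (L t (γ t))) = fun t ↦
      φ x + t * φ τ + ∑ i, (b.coord i (γ t) - b.coord i x) * φ (L t (b i)) := by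
    ext t
    have hγt : γ t = x + ∑ i, (b.coord i (γ t) - b.coord i x) • b i := by
      simp only [Module.Basis.coord_apply, sub_smul, Finset.sum_sub_distrib, b.sum_repr,
        add_sub_cancel]
    conv_lhs => rw [hγt]
    simp only [map_add, map_sum, map_smul, hLx, smul_eq_mul]
  refine ⟨fun t ↦ L t (γ t), by simp [hL0, h0], hX.mono fun t ht ↦ hLX t _ ht, fun φ ↦ ?_⟩
  rw [hexpand]
  refine ⟨.fun_add (by fun_prop) (Finset.analyticAt_fun_sum _ fun i _ ↦
    .fun_mul ((hγ (b.coord i)).1.fun_sub analyticAt_const) (hL φ (b i))), ?_⟩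
  have hterm (i) : HasDerivAt (fun t ↦ (b.coord i (γ t) - b.coord i x) * φ (L t (b i)))
      (b.coord i v * φ (b i)) 0 := by
    have hmul := ((hγ (b.coord i)).2.sub_const (b.coord i x)).fun_mul
      (hL φ (b i)).differentiableAt.hasDerivAt
    rwa [h0, hL0, sub_self, zero_mul, add_zero, LinearMap.id_apply] at hmul
  have hφv : φ v = ∑ i, b.coord i v * φ (b i) := by
    conv_lhs => rw [← b.sum_repr v]
    simp only [map_sum, map_smul, smul_eq_mul, Module.Basis.coord_apply]
  rw [map_add, hφv, add_comm]
  have hlin : HasDerivAt (fun t : ℂ ↦ φ x + t * φ τ) (φ τ) 0 := by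
    simpa using ((hasDerivAt_id (0 : ℂ)).mul_const (φ τ)).const_add (φ x)
  exact hlin.fun_add (HasDerivAt.fun_sum fun i _ ↦ hterm i)

end Tangent

/-! ## Polynomial maps and dominating parametrizations -/

section PolynomialMap

variable {P U V W W' : Type*} [AddCommGroup P] [Module ℂ P] [AddCommGroup U] [Module ℂ U]
  [AddCommGroup V] [Module ℂ V] [AddCommGroup W] [Module ℂ W] [AddCommGroup W'] [Module ℂ W']

/-- A polynomial map between complex vector spaces, tested on linear forms so that no coordinates
have to be chosen: the maps through which polynomials in the sense of `evalAt` pull back. -/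
def IsPolynomialMap (Φ : P → W) : Prop :=
  ∀ φ : Module.Dual ℂ W, ∃ F : MvPolynomial (Module.Dual ℂ P) ℂ, ∀ p, evalAt F p = φ (Φ p)

namespace IsPolynomialMap

theorem const (w : W) : IsPolynomialMap fun _ : P ↦ w := fun φ ↦
  ⟨MvPolynomial.C (φ w), fun _ ↦ MvPolynomial.eval_C _⟩

theorem linear (L : P →ₗ[ℂ] W) : IsPolynomialMap L := fun φ ↦
  ⟨MvPolynomial.X (φ ∘ₗ L), fun _ ↦ MvPolynomial.eval_X _⟩

theorem linear_comp {Φ : P → W} (hΦ : IsPolynomialMap Φ) (L : W →ₗ[ℂ] W') :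
    IsPolynomialMap fun p ↦ L (Φ p) := fun φ ↦ hΦ (φ ∘ₗ L)

theorem add {Φ Ψ : P → W} (hΦ : IsPolynomialMap Φ) (hΨ : IsPolynomialMap Ψ) :
    IsPolynomialMap fun p ↦ Φ p + Ψ p := fun φ ↦ by
  obtain ⟨F, hF⟩ := hΦ φ
  obtain ⟨G, hG⟩ := hΨ φ
  exact ⟨F + G, fun p ↦ by rw [map_add, ← hF, ← hG, evalAt, map_add]; rfl⟩

theorem smul {c : P → ℂ} {Φ : P → W} (hc : IsPolynomialMap c) (hΦ : IsPolynomialMap Φ) :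
    IsPolynomialMap fun p ↦ c p • Φ p := fun φ ↦ by
  obtain ⟨F, hF⟩ := hc LinearMap.id
  obtain ⟨G, hG⟩ := hΦ φ
  refine ⟨F * G, fun p ↦ ?_⟩
  rw [map_smul, smul_eq_mul, ← hG, ← LinearMap.id_apply (R := ℂ) (c p), ← hF, evalAt, map_mul]
  rfl

theorem sum {ι : Type*} (s : Finset ι) {Φ : ι → P → W} (hΦ : ∀ i, IsPolynomialMap (Φ i)) :
    IsPolynomialMap fun p ↦ ∑ i ∈ s, Φ i p := by
  classical
  induction s using Finset.induction_on with
  | empty => exact const 0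
  | insert i s hi ih => simpa only [Finset.sum_insert hi] using (hΦ i).add ih

theorem prod {ι : Type*} (s : Finset ι) {c : ι → P → ℂ} (hc : ∀ i, IsPolynomialMap (c i)) :
    IsPolynomialMap fun p ↦ ∏ i ∈ s, c i p := by
  classical
  induction s using Finset.induction_on with
  | empty => exact const 1
  | insert i s hi ih => simpa only [Finset.prod_insert hi, smul_eq_mul] using (hc i).smul ih

theorem multilinearMap [FiniteDimensional ℂ V] {k : ℕ} (f : MultilinearMap ℂ (fun _ : Fin k ↦ V) W)
    {v : Fin k → P → V} (hv : ∀ i, IsPolynomialMap (v i)) :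
    IsPolynomialMap fun p ↦ f fun i ↦ v i p := by
  let b := Module.finBasis ℂ V
  have hf (p : P) : (f fun i ↦ v i p) =
      ∑ s : Fin k → Fin (Module.finrank ℂ V),
        (∏ i, b.coord (s i) (v i p)) • f fun i ↦ b (s i) := by
    conv_lhs => enter [2, i]; rw [← b.sum_repr (v i p)]
    rw [f.map_sum]
    exact Finset.sum_congr rfl fun s _ ↦ f.map_smul_univ _ _
  simp only [hf]
  exact .sum _ fun s ↦ .smul (.prod _ fun i ↦ (hv i).linear_comp _) (.const _)

theorem exteriorPowerMap [FiniteDimensional ℂ U] [FiniteDimensional ℂ V] {k : ℕ}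
    {g : P → U →ₗ[ℂ] V} (hg : ∀ u, IsPolynomialMap fun p ↦ g p u) {y : P → ⋀[ℂ]^k U}
    (hy : IsPolynomialMap y) : IsPolynomialMap fun p ↦ exteriorPower.map k (g p) (y p) := by
  let b := Module.finBasis ℂ (⋀[ℂ]^k U)
  have hconst (η : ⋀[ℂ]^k U) : IsPolynomialMap fun p ↦ exteriorPower.map k (g p) η := by
    have hη : η ∈ Submodule.span ℂ (Set.range (exteriorPower.ιMulti ℂ k (M := U))) := by
      rw [exteriorPower.ιMulti_span]
      trivial
    induction hη using Submodule.span_induction with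
    | mem _ hu =>
      obtain ⟨u, rfl⟩ := hu
      simp only [exteriorPower.map_apply_ιMulti]
      exact multilinearMap (exteriorPower.ιMulti ℂ k).toMultilinearMap fun i ↦ hg (u i)
    | zero => simpa only [map_zero] using const 0
    | add η η' _ _ ih ih' => simpa only [map_add] using ih.add ih'
    | smul c η _ ih => simpa only [map_smul] using (const c).smul ih
  have hexpand (p : P) : exteriorPower.map k (g p) (y p) =
      ∑ i, b.coord i (y p) • exteriorPower.map k (g p) (b i) := by
    conv_lhs => rw [← b.sum_repr (y p)]
    simp only [map_sum, map_smul, Module.Basis.coord_apply]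
  simp only [hexpand]
  exact .sum _ fun i ↦ (hy.linear_comp _).smul (hconst _)

theorem analyticAt {Φ : ℂ → W} (hΦ : IsPolynomialMap Φ) (φ : Module.Dual ℂ W) (t₀ : ℂ) :
    AnalyticAt ℂ (fun t ↦ φ (Φ t)) t₀ := by
  obtain ⟨F, hF⟩ := hΦ φ
  simp only [← hF]
  refine AnalyticAt.aeval_mvPolynomial (A := ℂ) (f := fun t (ψ : Module.Dual ℂ ℂ) ↦ ψ t)
    (fun ψ ↦ ?_) F
  exact (LinearMap.toContinuousLinearMap ψ).analyticAt t₀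

theorem exists_algHom_eval_eq {Φ : P → W} (hΦ : IsPolynomialMap Φ) {ι : Type*} [Finite ι]
    (b : Module.Basis ι ℂ P) :
    ∃ ρ : MvPolynomial (Module.Dual ℂ W) ℂ →ₐ[ℂ] MvPolynomial ι ℂ,
      ∀ F x, MvPolynomial.eval x (ρ F) = evalAt F (Φ (b.equivFun.symm x)) := by
  have := Fintype.ofFinite ι
  choose G hG using hΦ
  let C : MvPolynomial (Module.Dual ℂ P) ℂ →ₐ[ℂ] MvPolynomial ι ℂ :=
    MvPolynomial.bind₁ fun ψ ↦ ∑ i, MvPolynomial.C (ψ (b i)) * MvPolynomial.X i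
  have hC (F x) : MvPolynomial.eval x (C F) = evalAt F (b.equivFun.symm x) := by
    have hψ (ψ : Module.Dual ℂ P) :
        MvPolynomial.eval x (∑ i, MvPolynomial.C (ψ (b i)) * MvPolynomial.X i) =
          ψ (b.equivFun.symm x) := by
      simp [b.equivFun_symm_apply, mul_comm]
    rw [evalAt, ← funext hψ]
    exact MvPolynomial.eval₂Hom_bind₁ _ _ _ F
  refine ⟨C.comp (MvPolynomial.bind₁ G), fun F x ↦ ?_⟩
  rw [AlgHom.comp_apply, hC, evalAt.eq_1 F, ← funext fun φ ↦ hG φ (b.equivFun.symm x)]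
  exact MvPolynomial.eval₂Hom_bind₁ _ _ _ F

theorem exists_algHom_eq_zero_iff [FiniteDimensional ℂ P] {Φ : P → W} (hΦ : IsPolynomialMap Φ) :
    ∃ ρ : MvPolynomial (Module.Dual ℂ W) ℂ →ₐ[ℂ] MvPolynomial (Fin (Module.finrank ℂ P)) ℂ,
      ∀ F, ρ F = 0 ↔ ∀ p, evalAt F (Φ p) = 0 := by
  let b := Module.finBasis ℂ P
  obtain ⟨ρ, hρ⟩ := hΦ.exists_algHom_eval_eq b
  refine ⟨ρ, fun F ↦ ?_⟩
  simp only [MvPolynomial.funext_iff, hρ, map_zero]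
  exact (b.equivFun.symm.surjective.forall (p := fun p ↦ evalAt F (Φ p) = 0)).symm

end IsPolynomialMap

variable [FiniteDimensional ℂ P] {X : Set (ℙ ℂ W)} {Φ : P → W}

theorem isPrime_vanishingIdeal (hΦ : IsPolynomialMap Φ)
    (hX : ∀ F, F ∈ vanishingIdeal X ↔ ∀ p, evalAt F (Φ p) = 0) : (vanishingIdeal X).IsPrime := by
  obtain ⟨ρ, hρ⟩ := hΦ.exists_algHom_eq_zero_iff
  have hker : RingHom.ker ρ = vanishingIdeal X := Ideal.ext fun F ↦ (hρ F).trans (hX F).symm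
  exact hker ▸ RingHom.ker_isPrime ρ

theorem trdeg_coordinateRing_le (hΦ : IsPolynomialMap Φ)
    (hX : ∀ F, (∀ p, evalAt F (Φ p) = 0) → F ∈ vanishingIdeal X) :
    Algebra.trdeg ℂ (CoordinateRing X) ≤ Module.finrank ℂ P := by
  obtain ⟨ρ, hρ⟩ := hΦ.exists_algHom_eq_zero_iff
  have hker : RingHom.ker ρ ≤ vanishingIdeal X := fun F hF ↦ hX F ((hρ F).mp hF)
  have hfactor := trdeg_le_of_surjective (Ideal.Quotient.factorₐ ℂ hker)
    (Ideal.Quotient.factor_surjective hker)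
  have hlift := lift_trdeg_le_of_injective (Ideal.kerLiftAlg ρ) (Ideal.kerLiftAlg_injective ρ)
  rw [MvPolynomial.trdeg_of_isDomain] at hlift
  exact hfactor.trans (by simpa using hlift)

end PolynomialMap

/-! ## Linear images of a fixed element of an exterior power -/

section ImageCone

variable {U V : Type*} [AddCommGroup U] [Module ℂ U] [AddCommGroup V] [Module ℂ V] {k : ℕ}

/-- The cone over `S` consists of the images of a model element `ξ ∈ ⋀^k U` under all linear maps
`U → V`. Grassmannians and the sets whose closures are the secant varieties are all of this
form. -/
def IsImageCone (S : Set (ℙ ℂ (⋀[ℂ]^k V))) (ξ : ⋀[ℂ]^k U) : Prop :=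
  ∀ w, w ∈ cone S ↔ ∃ g : U →ₗ[ℂ] V, exteriorPower.map k g ξ = w

/-- The cone over `X` is stable under all endomorphisms of `V`. -/
def IsMapStable (X : Set (ℙ ℂ (⋀[ℂ]^k V))) : Prop :=
  ∀ A : V →ₗ[ℂ] V, ∀ w ∈ cone X, exteriorPower.map k A w ∈ cone X

/-- The velocities `τ` of lines `t ↦ ⋀^k (g₀ + t h) ξ = ⋀^k g₀ ξ + t τ` of images of `ξ`, as they
arise when `h` moves a single vector of a basis of `U`. -/
def lineDirections (ξ : ⋀[ℂ]^k U) (g₀ : U →ₗ[ℂ] V) : Set (⋀[ℂ]^k V) :=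
  {τ | ∃ h : U →ₗ[ℂ] V, ∀ t : ℂ,
    exteriorPower.map k (g₀ + t • h) ξ = exteriorPower.map k g₀ ξ + t • τ}

variable {S X : Set (ℙ ℂ (⋀[ℂ]^k V))} {ξ : ⋀[ℂ]^k U} {g₀ : U →ₗ[ℂ] V} {p : V →ₗ[ℂ] U}

theorem exteriorPower_map_map {U' : Type*} [AddCommGroup U'] [Module ℂ U'] (A : V →ₗ[ℂ] U')
    (g : U →ₗ[ℂ] V) (y : ⋀[ℂ]^k U) :
    exteriorPower.map k A (exteriorPower.map k g y) = exteriorPower.map k (A ∘ₗ g) y :=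
  (LinearMap.congr_fun (exteriorPower.map_comp g A) y).symm

theorem IsImageCone.isMapStable (hS : IsImageCone S ξ) : IsMapStable S := by
  intro A w hw
  obtain ⟨g, rfl⟩ := (hS w).mp hw
  exact (hS _).mpr ⟨A ∘ₗ g, (exteriorPower_map_map A g ξ).symm⟩

theorem IsMapStable.zariskiClosure (hS : IsMapStable S) : IsMapStable (zariskiClosure S) :=
  fun A _ hw ↦ map_mem_cone_zariskiClosure (hS A) hw

/-- If `u = p ∘ g` is invertible, then `g ∘ u⁻¹` differs from `g₀` by a map into `ker p`. -/
theorem evalAt_map_eq_zero_of_isUnit {F : MvPolynomial (Module.Dual ℂ (⋀[ℂ]^k V)) ℂ}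
    (hp : p ∘ₗ g₀ = .id)
    (hF : ∀ (N : U →ₗ[ℂ] LinearMap.ker p) (y : ⋀[ℂ]^k U),
      evalAt F (exteriorPower.map k (g₀ + (LinearMap.ker p).subtype ∘ₗ N) y) = 0)
    {g : U →ₗ[ℂ] V} (hg : IsUnit (p ∘ₗ g : Module.End ℂ U)) (y : ⋀[ℂ]^k U) :
    evalAt F (exteriorPower.map k g y) = 0 := by
  obtain ⟨u, hu⟩ := hg
  have huv : p ∘ₗ g ∘ₗ (↑u⁻¹ : Module.End ℂ U) = .id := by
    rw [← LinearMap.comp_assoc, ← hu]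
    exact u.mul_inv
  have hvu : (↑u⁻¹ : Module.End ℂ U) ∘ₗ (u : Module.End ℂ U) = .id := u.inv_mul
  have hN (x : U) : (g ∘ₗ (↑u⁻¹ : Module.End ℂ U) - g₀) x ∈ LinearMap.ker p := by
    rw [LinearMap.mem_ker, ← LinearMap.comp_apply, LinearMap.comp_sub, huv, hp, sub_self,
      LinearMap.zero_apply]
  have hNy := hF (LinearMap.codRestrict _ _ hN) (exteriorPower.map k (u : Module.End ℂ U) y)
  rwa [LinearMap.subtype_comp_codRestrict, add_sub_cancel, exteriorPower_map_map,
    LinearMap.comp_assoc, hvu, LinearMap.comp_id] at hNy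

theorem isPolynomialMap_add_smul (g h : U →ₗ[ℂ] V) (u : U) :
    IsPolynomialMap fun t : ℂ ↦ (g + t • h) u :=
  (IsPolynomialMap.const (g u)).add (.smul (.linear .id) (.const (h u)))

section Tangent

variable [FiniteDimensional ℂ V] {τ v : ⋀[ℂ]^k V} {T : Submodule ℂ (⋀[ℂ]^k V)}

theorem IsMapStable.add_mem_coneTangentSpace_of_mem_lineDirections (hX : IsMapStable X)
    (hp : p ∘ₗ g₀ = .id) (hτ : τ ∈ lineDirections ξ g₀)
    (hv : v ∈ coneTangentSpace X (exteriorPower.map k g₀ ξ)) :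
    v + τ ∈ coneTangentSpace X (exteriorPower.map k g₀ ξ) := by
  obtain ⟨h, hh⟩ := hτ
  refine add_mem_coneTangentSpace (fun t ↦ exteriorPower.map k (.id + t • (h ∘ₗ p))) ?_
    (fun t ↦ hX _) (fun φ w ↦ ?_) (fun t ↦ ?_) hv
  · rw [zero_smul, add_zero, exteriorPower.map_id]
  · exact (IsPolynomialMap.exteriorPowerMap
      (isPolynomialMap_add_smul _ _) (.const w)).analyticAt φ 0
  · rw [← hh, exteriorPower_map_map, LinearMap.add_comp, LinearMap.smul_comp,
      LinearMap.comp_assoc, hp, LinearMap.id_comp, LinearMap.comp_id]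

theorem IsMapStable.add_mem_coneTangentSpace (hX : IsMapStable X) (hp : p ∘ₗ g₀ = .id)
    (hτ : τ ∈ Submodule.span ℂ (lineDirections ξ g₀))
    (hv : v ∈ coneTangentSpace X (exteriorPower.map k g₀ ξ)) :
    v + τ ∈ coneTangentSpace X (exteriorPower.map k g₀ ξ) := by
  induction hτ using Submodule.span_induction generalizing v with
  | mem τ hτ => exact hX.add_mem_coneTangentSpace_of_mem_lineDirections hp hτ hv
  | zero => rwa [add_zero]
  | add τ τ' _ _ ih ih' => exact add_assoc v τ τ' ▸ ih' (ih hv)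
  | smul c τ _ ih =>
    rcases eq_or_ne c 0 with rfl | hc
    · rwa [zero_smul, add_zero]
    · have hmem := smul_mem_coneTangentSpace (ih (smul_mem_coneTangentSpace hv c⁻¹)) c
      rwa [smul_add, smul_inv_smul₀ hc] at hmem

theorem IsMapStable.subset_coneTangentSpace (hX : IsMapStable X) (hp : p ∘ₗ g₀ = .id)
    (hx : exteriorPower.map k g₀ ξ ∈ cone X) (hT : T ≤ Submodule.span ℂ (lineDirections ξ g₀)) :
    (T : Set (⋀[ℂ]^k V)) ⊆ coneTangentSpace X (exteriorPower.map k g₀ ξ) := fun τ hτ ↦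
  zero_add τ ▸ hX.add_mem_coneTangentSpace hp (hT hτ) (zero_mem_coneTangentSpace hx)

theorem IsMapStable.sup_span_singleton_subset_coneTangentSpace (hX : IsMapStable X)
    (hp : p ∘ₗ g₀ = .id) (hT : T ≤ Submodule.span ℂ (lineDirections ξ g₀))
    (hv : v ∈ coneTangentSpace X (exteriorPower.map k g₀ ξ)) :
    ((T ⊔ Submodule.span ℂ {v} : Submodule ℂ (⋀[ℂ]^k V)) : Set (⋀[ℂ]^k V)) ⊆
      coneTangentSpace X (exteriorPower.map k g₀ ξ) := by
  intro w hw
  obtain ⟨τ, hτ, u, hu, rfl⟩ := Submodule.mem_sup.mp hw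
  obtain ⟨c, rfl⟩ := Submodule.mem_span_singleton.mp hu
  exact add_comm (c • v) τ ▸
    hX.add_mem_coneTangentSpace hp (hT hτ) (smul_mem_coneTangentSpace hv c)

theorem IsImageCone.subset_coneTangentSpace (hS : IsImageCone S ξ) (hg₀ : Function.Injective g₀)
    (hT : T ≤ Submodule.span ℂ (lineDirections ξ g₀)) :
    (T : Set (⋀[ℂ]^k V)) ⊆ coneTangentSpace S (exteriorPower.map k g₀ ξ) := by
  obtain ⟨p, hp⟩ := g₀.exists_leftInverse_of_injective (LinearMap.ker_eq_bot.mpr hg₀)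
  exact hS.isMapStable.subset_coneTangentSpace hp ((hS _).mpr ⟨g₀, rfl⟩) hT

theorem finrank_ker_of_comp_eq_id (hp : p ∘ₗ g₀ = .id) :
    Module.finrank ℂ (LinearMap.ker p) = Module.finrank ℂ V - Module.finrank ℂ U := by
  have hrange : LinearMap.range p = ⊤ := LinearMap.range_eq_top.mpr <|
    Function.RightInverse.surjective (g := g₀) (LinearMap.congr_fun hp)
  rw [← p.finrank_range_add_finrank_ker, hrange, finrank_top, Nat.add_sub_cancel_left]

end Tangent

variable [FiniteDimensional ℂ U] [FiniteDimensional ℂ V]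
  {F : MvPolynomial (Module.Dual ℂ (⋀[ℂ]^k V)) ℂ} {T : Submodule ℂ (⋀[ℂ]^k V)}

variable (U V k) in
/-- The dimension of the chart `(N, y) ↦ ⋀^k (g₀ + N) y` around `g₀ : U → V`, where `y ∈ ⋀^k U` and
`N` maps `U` into a complement of the range of `g₀`. It bounds the dimension of every image cone. -/
def chartDim : ℕ :=
  (Module.finrank ℂ U).choose k +
    Module.finrank ℂ U * (Module.finrank ℂ V - Module.finrank ℂ U)

theorem IsImageCone.isPrime_vanishingIdeal_zariskiClosure (hS : IsImageCone S ξ) :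
    (vanishingIdeal (zariskiClosure S)).IsPrime := by
  refine isPrime_vanishingIdeal (Φ := fun g : U →ₗ[ℂ] V ↦ exteriorPower.map k g ξ)
    (.exteriorPowerMap (fun u ↦ .linear (LinearMap.applyₗ u)) (.const ξ)) fun F ↦ ?_
  simp only [mem_vanishingIdeal_zariskiClosure, hS _, forall_exists_index,
    forall_apply_eq_imp_iff]

theorem evalAt_map_eq_zero (hp : p ∘ₗ g₀ = .id)
    (hF : ∀ (N : U →ₗ[ℂ] LinearMap.ker p) (y : ⋀[ℂ]^k U),
      evalAt F (exteriorPower.map k (g₀ + (LinearMap.ker p).subtype ∘ₗ N) y) = 0)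
    (g : U →ₗ[ℂ] V) (y : ⋀[ℂ]^k U) : evalAt F (exteriorPower.map k g y) = 0 := by
  have hpoly : IsPolynomialMap fun t : ℂ ↦ exteriorPower.map k (g + t • -g₀) y :=
    .exteriorPowerMap (isPolynomialMap_add_smul g (-g₀)) (.const y)
  have hcont : Continuous fun t : ℂ ↦ evalAt F (exteriorPower.map k (g + t • -g₀) y) :=
    (MvPolynomial.continuous_eval F).comp <| continuous_pi fun φ ↦
      continuous_iff_continuousAt.mpr fun t ↦ (hpoly.analyticAt φ t).continuousAt
  have hdense : Dense (spectrum ℂ (p ∘ₗ g : Module.End ℂ U))ᶜ :=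
    (Module.End.finite_spectrum _).countable.dense_compl ℂ
  have hzero : Set.EqOn (fun t : ℂ ↦ evalAt F (exteriorPower.map k (g + t • -g₀) y)) (fun _ ↦ 0)
      (spectrum ℂ (p ∘ₗ g : Module.End ℂ U))ᶜ := fun t ht ↦ by
    refine evalAt_map_eq_zero_of_isUnit hp hF ?_ y
    have hpg : p ∘ₗ (g + t • -g₀) = -(algebraMap ℂ (Module.End ℂ U) t - p ∘ₗ g) := by
      rw [LinearMap.comp_add, LinearMap.comp_smul, LinearMap.comp_neg, hp,
        Algebra.algebraMap_eq_smul_one, smul_neg, neg_sub, ← sub_eq_add_neg]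
      rfl
    exact hpg ▸ (spectrum.notMem_iff.mp ht).neg
  simpa using congrFun (hcont.ext_on hdense continuous_const hzero) 0

theorem IsImageCone.trdeg_coordinateRing_le (hS : IsImageCone S ξ) (hp : p ∘ₗ g₀ = .id) :
    Algebra.trdeg ℂ (CoordinateRing (RestrictedSecant.zariskiClosure S)) ≤ chartDim U V k := by
  have hdim : chartDim U V k =
      Module.finrank ℂ ((⋀[ℂ]^k U) × (U →ₗ[ℂ] LinearMap.ker p)) := by
    rw [Module.finrank_prod, Module.finrank_linearMap, exteriorPower.finrank_eq,
      finrank_ker_of_comp_eq_id hp, chartDim]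
  rw [hdim]
  refine RestrictedSecant.trdeg_coordinateRing_le (Φ := fun q ↦
      exteriorPower.map k (g₀ + (LinearMap.ker p).subtype ∘ₗ q.2) q.1)
    (.exteriorPowerMap (fun u ↦ ?_) (y := ⇑(LinearMap.fst ℂ (⋀[ℂ]^k U) _)) (.linear _))
    fun F hF ↦ ?_
  · exact (IsPolynomialMap.const (g₀ u)).add
      ((IsPolynomialMap.linear (.snd ℂ (⋀[ℂ]^k U) _)).linear_comp
      ((LinearMap.ker p).subtype ∘ₗ LinearMap.applyₗ u))
  · rw [mem_vanishingIdeal_zariskiClosure]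
    intro w hw
    obtain ⟨g, rfl⟩ := (hS w).mp hw
    exact evalAt_map_eq_zero hp (fun N y ↦ hF (y, N)) g ξ

theorem IsImageCone.finrank_le_chartDim (hS : IsImageCone S ξ) (hg₀ : Function.Injective g₀)
    {x : ⋀[ℂ]^k V} (hT : (T : Set (⋀[ℂ]^k V)) ⊆ coneTangentSpace (zariskiClosure S) x) :
    Module.finrank ℂ T ≤ chartDim U V k := by
  obtain ⟨p, hp⟩ := g₀.exists_leftInverse_of_injective (LinearMap.ker_eq_bot.mpr hg₀)
  exact_mod_cast (finrank_le_trdeg_coordinateRing hT).trans (hS.trdeg_coordinateRing_le hp)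

variable (hS : IsImageCone S ξ) (hg₀ : Function.Injective g₀)
  (hT : T ≤ Submodule.span ℂ (lineDirections ξ g₀))
include hS hg₀ hT

theorem IsImageCone.finrank_le_chartDim_of_le_span_lineDirections :
    Module.finrank ℂ T ≤ chartDim U V k :=
  hS.finrank_le_chartDim hg₀ <|
    (hS.subset_coneTangentSpace hg₀ hT).trans (coneTangentSpace_mono (subset_zariskiClosure S) _)

theorem IsImageCone.coneTangentSpace_zariskiClosure
    (hdim : chartDim U V k ≤ Module.finrank ℂ T) :
    coneTangentSpace (zariskiClosure S) (exteriorPower.map k g₀ ξ) = T := by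
  refine (Set.Subset.antisymm
    ((hS.subset_coneTangentSpace hg₀ hT).trans (coneTangentSpace_mono (subset_zariskiClosure S) _))
    fun v hv ↦ ?_).symm
  obtain ⟨p, hp⟩ := g₀.exists_leftInverse_of_injective (LinearMap.ker_eq_bot.mpr hg₀)
  have hTv := hS.isMapStable.zariskiClosure.sup_span_singleton_subset_coneTangentSpace hp hT hv
  have hle : T = T ⊔ Submodule.span ℂ {v} := Submodule.eq_of_le_of_finrank_le le_sup_left
    ((hS.finrank_le_chartDim hg₀ hTv).trans hdim)
  exact hle ▸ Submodule.mem_sup_right (Submodule.mem_span_singleton_self v)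

theorem IsImageCone.coneTangentSpace_eq (hdim : chartDim U V k ≤ Module.finrank ℂ T) :
    coneTangentSpace S (exteriorPower.map k g₀ ξ) = T :=
  ((coneTangentSpace_mono (subset_zariskiClosure S) _).trans
    (hS.coneTangentSpace_zariskiClosure hg₀ hT hdim).le).antisymm
    (hS.subset_coneTangentSpace hg₀ hT)

theorem IsImageCone.hasDim_zariskiClosure {d : ℕ} (hdim : chartDim U V k ≤ Module.finrank ℂ T)
    (hd : Module.finrank ℂ T = d + 1) : HasDim (zariskiClosure S) d := by
  obtain ⟨p, hp⟩ := g₀.exists_leftInverse_of_injective (LinearMap.ker_eq_bot.mpr hg₀)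
  have := hS.isPrime_vanishingIdeal_zariskiClosure
  have htrdeg := (hS.trdeg_coordinateRing_le hp).trans (Nat.cast_le.mpr hdim)
  refine ringKrullDim_eq_of_trdeg_eq (k := ℂ) (hd ▸ htrdeg.antisymm ?_)
  exact finrank_le_trdeg_coordinateRing (hS.coneTangentSpace_zariskiClosure hg₀ hT hdim).ge

end ImageCone

/-! ## Products with vectors -/

section Wedge

variable {U V : Type*} [AddCommGroup U] [Module ℂ U] [AddCommGroup V] [Module ℂ V] {k : ℕ}

/-- The product `v ∧ w` of a vector `v` and an element `w` of `⋀^k V`, as a bilinear map. -/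
def wedge : V →ₗ[ℂ] ⋀[ℂ]^k V →ₗ[ℂ] ⋀[ℂ]^(k + 1) V :=
  LinearMap.mk₂ ℂ
    (fun v w ↦ ⟨ExteriorAlgebra.ι ℂ v * w, (pow_succ' (LinearMap.range (ExteriorAlgebra.ι ℂ)) k).ge
      (Submodule.mul_mem_mul (LinearMap.mem_range_self _ v) w.2)⟩)
    (fun v v' w ↦ Subtype.ext <| by simp only [map_add, add_mul, Submodule.coe_add])
    (fun c v w ↦ Subtype.ext <| by simp only [map_smul, smul_mul_assoc, Submodule.coe_smul])
    (fun v w w' ↦ Subtype.ext <| by simp only [mul_add, Submodule.coe_add])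
    (fun c v w ↦ Subtype.ext <| by simp only [mul_smul_comm, Submodule.coe_smul])

/-- The bivector `a ∧ b`. -/
abbrev wedge₂ (a b : V) : ⋀[ℂ]^2 V := exteriorPower.ιMulti ℂ 2 ![a, b]

/-- The trivector `a ∧ b ∧ c`. -/
abbrev wedge₃ (a b c : V) : ⋀[ℂ]^3 V := exteriorPower.ιMulti ℂ 3 ![a, b, c]

theorem ιMulti_eq_wedge₃ (v : Fin 3 → V) :
    exteriorPower.ιMulti ℂ 3 v = wedge₃ (v 0) (v 1) (v 2) :=
  congrArg _ (List.ofFn_injective rfl)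

theorem wedge_ιMulti (a : V) (v : Fin k → V) :
    wedge a (exteriorPower.ιMulti ℂ k v) = exteriorPower.ιMulti ℂ (k + 1) (Matrix.vecCons a v) :=
  Subtype.ext (ExteriorAlgebra.ιMulti_succ_apply (Matrix.vecCons a v)).symm

theorem wedge_wedge₂ (a b c : V) : wedge a (wedge₂ b c) = wedge₃ a b c := wedge_ιMulti a ![b, c]

theorem wedge₃_swap₁₂ (a b c : V) : wedge₃ b a c = -wedge₃ a b c := by
  rw [← (exteriorPower.ιMulti ℂ 3).map_swap ![a, b, c] (i := 0) (j := 1) (by decide)]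
  congr! 1
  ext i
  fin_cases i <;> rfl

theorem wedge₃_swap₂₃ (a b c : V) : wedge₃ a c b = -wedge₃ a b c := by
  rw [← (exteriorPower.ιMulti ℂ 3).map_swap ![a, b, c] (i := 1) (j := 2) (by decide)]
  congr! 1
  ext i
  fin_cases i <;> rfl

theorem wedge₃_rotate (a b c : V) : wedge₃ b c a = wedge₃ a b c := by
  rw [wedge₃_swap₂₃, wedge₃_swap₁₂, neg_neg]

theorem map_wedge₃ (g : U →ₗ[ℂ] V) (a b c : U) :
    exteriorPower.map 3 g (wedge₃ a b c) = wedge₃ (g a) (g b) (g c) := by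
  rw [exteriorPower.map_apply_ιMulti]
  congr! 1
  ext i
  fin_cases i <;> rfl

theorem dot_le {S : Set (⋀[ℂ]^k V)} {N : Submodule ℂ (⋀[ℂ]^(k + 1) V)} :
    dot S ≤ N ↔ ∀ w ∈ S, ∀ v, wedge v w ∈ N :=
  Submodule.span_le.trans ⟨fun h w hw v ↦ h ⟨v, w, hw, rfl⟩,
    fun h x ⟨v, w, hw, hx⟩ ↦ (Subtype.ext hx : x = wedge v w) ▸ h w hw v⟩

theorem wedge_mem_dot {S : Set (⋀[ℂ]^k V)} {w : ⋀[ℂ]^k V} (hw : w ∈ S) (v : V) :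
    wedge v w ∈ dot S :=
  dot_le.mp le_rfl w hw v

theorem wedge₃_mem_dot_fst {S : Set (⋀[ℂ]^2 V)} {b c : V} (h : wedge₂ b c ∈ S) (a : V) :
    wedge₃ a b c ∈ dot S :=
  wedge_wedge₂ a b c ▸ wedge_mem_dot h a

theorem wedge₃_mem_dot_snd {S : Set (⋀[ℂ]^2 V)} {a c : V} (h : wedge₂ a c ∈ S) (b : V) :
    wedge₃ a b c ∈ dot S := by
  rw [wedge₃_swap₁₂]
  exact neg_mem (wedge₃_mem_dot_fst h b)

theorem wedge₃_mem_dot_thd {S : Set (⋀[ℂ]^2 V)} {a b : V} (h : wedge₂ a b ∈ S) (c : V) :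
    wedge₃ a b c ∈ dot S := by
  rw [wedge₃_rotate]
  exact wedge₃_mem_dot_fst h c

theorem dot_union (S S' : Set (⋀[ℂ]^k V)) : dot (S ∪ S') = dot S ⊔ dot S' := by
  refine le_antisymm (dot_le.mpr fun w hw v ↦ ?_) (sup_le ?_ ?_)
  · exact hw.elim (fun hw ↦ Submodule.mem_sup_left (wedge_mem_dot hw v))
      (fun hw ↦ Submodule.mem_sup_right (wedge_mem_dot hw v))
  · exact dot_le.mpr fun w hw v ↦ wedge_mem_dot (.inl hw) v
  · exact dot_le.mpr fun w hw v ↦ wedge_mem_dot (.inr hw) v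

end Wedge

/-! ## The cones over Grassmannians and over sets of secant points -/

section Cones

variable {V : Type*} [AddCommGroup V] [Module ℂ V] {k s : ℕ}

theorem mem_pluckerLine_iff {E : Submodule ℂ V} (b : Module.Basis (Fin k) ℂ E) {w : ⋀[ℂ]^k V} :
    w ∈ pluckerLine k E ↔ ∃ c : ℂ, c • exteriorPower.ιMulti ℂ k (fun i ↦ (b i : V)) = w := by
  have := Module.Basis.finiteDimensional_of_finite b
  have hfinrank : Module.finrank ℂ (⋀[ℂ]^k E) = 1 := by
    rw [exteriorPower.finrank_eq, Module.finrank_eq_card_basis b, Fintype.card_fin,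
      Nat.choose_self]
  have hne : exteriorPower.ιMulti ℂ k b ≠ 0 := fun h ↦ by
    have hdet := exteriorPower.alternatingMapLinearEquiv_apply_ιMulti b.det b
    exact zero_ne_one (α := ℂ) (by rwa [h, b.det_self, map_zero] at hdet)
  have hmap (c : ℂ) : c • exteriorPower.ιMulti ℂ k (fun i ↦ (b i : V)) =
      exteriorPower.map k E.subtype (c • exteriorPower.ιMulti ℂ k b) := by
    rw [map_smul, exteriorPower.map_apply_ιMulti]
    rfl
  simp only [hmap]
  refine ⟨fun ⟨x, hx⟩ ↦ ?_, fun ⟨c, hc⟩ ↦ ⟨_, hc⟩⟩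
  obtain ⟨c, rfl⟩ := (finrank_eq_one_iff_of_nonzero' _ hne).mp hfinrank x
  exact ⟨c, hx⟩

theorem exists_basis_zero_eq {E : Type*} [AddCommGroup E] [Module ℂ E]
    (hE : Module.finrank ℂ E = k + 1) {u : E} (hu : u ≠ 0) :
    ∃ b : Module.Basis (Fin (k + 1)) ℂ E, b 0 = u := by
  have : FiniteDimensional ℂ E := .of_finrank_pos (hE ▸ k.succ_pos)
  obtain ⟨N, hN⟩ := (Submodule.span ℂ {u}).exists_isCompl
  have hfinrank : Module.finrank ℂ N = k := by
    have := Submodule.finrank_add_eq_of_isCompl hN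
    rw [finrank_span_singleton hu] at this
    omega
  refine ⟨.mkFinCons u (Module.finBasisOfFinrankEq ℂ N hfinrank) (fun c x hx hcx ↦ ?_)
    (fun z ↦ ?_), by rw [Module.Basis.coe_mkFinCons, Fin.cons_zero]⟩
  · have hcu : c • u ∈ N := eq_neg_of_add_eq_zero_left hcx ▸ N.neg_mem hx
    have h0 := Submodule.disjoint_def.mp hN.disjoint (c • u)
      (Submodule.smul_mem _ c (Submodule.mem_span_singleton_self u)) hcu
    exact (smul_eq_zero.mp h0).resolve_right hu
  · obtain ⟨y, hy, x, hx, rfl⟩ := Submodule.mem_sup.mp (hN.sup_eq_top ▸ Submodule.mem_top (x := z))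
    obtain ⟨c, rfl⟩ := Submodule.mem_span_singleton.mp hy
    exact ⟨-c, by rwa [neg_smul, add_neg_cancel_comm]⟩

theorem exists_smul_ιMulti_vecCons_eq {E : Submodule ℂ V} (hE : Module.finrank ℂ E = k + 1)
    {u : V} (hu : u ∈ E) (hu0 : u ≠ 0) {w : ⋀[ℂ]^(k + 1) V} (hw : w ∈ pluckerLine (k + 1) E) :
    ∃ (c : ℂ) (v : Fin k → V), c • exteriorPower.ιMulti ℂ (k + 1) (Matrix.vecCons u v) = w := by
  obtain ⟨b, hb⟩ := exists_basis_zero_eq hE (u := ⟨u, hu⟩) (Subtype.coe_ne_coe.mp hu0)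
  obtain ⟨c, rfl⟩ := (mem_pluckerLine_iff b).mp hw
  refine ⟨c, fun i ↦ b i.succ, ?_⟩
  congr 2
  refine funext (Fin.cases ?_ fun _ ↦ rfl)
  exact (congrArg Subtype.val hb).symm

theorem exists_pluckerLine_eq_span {v : Fin k → V} (hv : exteriorPower.ιMulti ℂ k v ≠ 0) :
    ∃ E : Submodule ℂ V, Module.finrank ℂ E = k ∧ (∀ i, v i ∈ E) ∧
      pluckerLine k E = Submodule.span ℂ {exteriorPower.ιMulti ℂ k v} := by
  have hli : LinearIndependent ℂ v := by
    by_contra hdep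
    exact hv (AlternatingMap.map_linearDependent _ v hdep)
  refine ⟨Submodule.span ℂ (Set.range v), by rw [finrank_span_eq_card hli, Fintype.card_fin],
    fun i ↦ Submodule.subset_span ⟨i, rfl⟩, ?_⟩
  ext w
  simp only [mem_pluckerLine_iff (Module.Basis.span hli), Module.Basis.span_apply,
    Submodule.mem_span_singleton]

theorem exists_ιMulti_eq_smul (v : Fin (k + 1) → V) (c : ℂ) :
    ∃ v', exteriorPower.ιMulti ℂ (k + 1) v' = c • exteriorPower.ιMulti ℂ (k + 1) v :=
  ⟨_, by rw [(exteriorPower.ιMulti ℂ (k + 1)).map_update_smul v 0 c (v 0),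
    Function.update_eq_self]⟩

theorem mem_cone_grassmannian {w : ⋀[ℂ]^(k + 1) V} :
    w ∈ cone (grassmannian V (k + 1)) ↔ ∃ v, exteriorPower.ιMulti ℂ (k + 1) v = w := by
  constructor
  · intro hw
    rcases eq_or_ne w 0 with rfl | hw0
    · exact ⟨0, AlternatingMap.map_zero _⟩
    obtain ⟨E, hE, hEw⟩ := hw hw0
    have : FiniteDimensional ℂ E := .of_finrank_pos (hE ▸ k.succ_pos)
    have hwE : w ∈ pluckerLine (k + 1) E := by
      rw [← hEw, Projectivization.submodule_mk]
      exact Submodule.mem_span_singleton_self w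
    obtain ⟨c, rfl⟩ := (mem_pluckerLine_iff (Module.finBasisOfFinrankEq ℂ E hE)).mp hwE
    exact exists_ιMulti_eq_smul _ c
  · rintro ⟨v, rfl⟩ hv
    obtain ⟨E, hE, -, hEv⟩ := exists_pluckerLine_eq_span hv
    exact ⟨E, hE, (Projectivization.submodule_mk _ hv).trans hEv.symm⟩

/-- The union of the spans of `s` points of `X`, whose Zariski closure is the `s`-secant variety
of `X`. -/
def secantPoints {W : Type*} [AddCommGroup W] [Module ℂ W] (s : ℕ) (X : Set (ℙ ℂ W)) :
    Set (ℙ ℂ W) :=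
  {p | ∃ x : Fin s → ℙ ℂ W, (∀ i, x i ∈ X) ∧ p.submodule ≤ ⨆ i, (x i).submodule}

variable (V) in
/-- The union of the spans of `s` points of `Gr(k, V)` whose `k`-planes have an intersection of
dimension at least `r`. Its Zariski closure is the `r`-restricted `s`-secant variety. -/
def restrictedSecantPoints (s r k : ℕ) : Set (ℙ ℂ (⋀[ℂ]^k V)) :=
  {p | ∃ E : Fin s → Submodule ℂ V, (∀ i, Module.finrank ℂ (E i) = k) ∧
    r ≤ Module.finrank ℂ (⨅ i, E i : Submodule ℂ V) ∧ p.submodule ≤ ⨆ i, pluckerLine k (E i)}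

theorem mk_submodule_le_iSup_iff {W : Type*} [AddCommGroup W] [Module ℂ W] {ι : Type*} [Fintype ι]
    {L : ι → Submodule ℂ W} {w : W} (hw : w ≠ 0) :
    (Projectivization.mk ℂ w hw).submodule ≤ ⨆ i, L i ↔
      ∃ x : ι → W, (∀ i, x i ∈ L i) ∧ ∑ i, x i = w := by
  rw [Projectivization.submodule_mk, Submodule.span_singleton_le_iff_mem,
    ← iSup_univ, ← Finset.coe_univ]
  refine (Submodule.mem_iSup_finset_iff_exists_sum _ _).trans
    ⟨fun ⟨x, hx⟩ ↦ ⟨fun i ↦ x i, fun i ↦ (x i).2, hx⟩,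
      fun ⟨x, hxL, hx⟩ ↦ ⟨fun i ↦ ⟨x i, hxL i⟩, hx⟩⟩

theorem mem_cone_of_mem_submodule {W : Type*} [AddCommGroup W] [Module ℂ W] {X : Set (ℙ ℂ W)}
    {p : ℙ ℂ W} (hp : p ∈ X) {w : W} (hw : w ∈ p.submodule) : w ∈ cone X := by
  rw [Projectivization.submodule_eq] at hw
  obtain ⟨c, rfl⟩ := Submodule.mem_span_singleton.mp hw
  exact smul_mem_cone (rep_mem_cone hp) c

theorem mem_cone_secantPoints {W : Type*} [AddCommGroup W] [Module ℂ W] {X : Set (ℙ ℂ W)} {w : W} :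
    w ∈ cone (secantPoints s X) ↔ ∃ x : Fin s → W, (∀ i, x i ∈ cone X) ∧ ∑ i, x i = w := by
  constructor
  · intro hw
    rcases eq_or_ne w 0 with rfl | hw0
    · exact ⟨0, fun _ ↦ zero_mem_cone X, Finset.sum_const_zero⟩
    obtain ⟨p, hp, hpw⟩ := hw hw0
    obtain ⟨x, hx, rfl⟩ := (mk_submodule_le_iSup_iff hw0).mp hpw
    exact ⟨x, fun i ↦ mem_cone_of_mem_submodule (hp i) (hx i), rfl⟩
  · rintro ⟨x, hx, rfl⟩ hw
    obtain ⟨j, -, hj⟩ := Finset.exists_ne_zero_of_sum_ne_zero hw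
    have hpoint (i : Fin s) : ∃ p ∈ X, x i ∈ p.submodule := by
      rcases eq_or_ne (x i) 0 with hi | hi
      · exact ⟨_, hx j hj, hi ▸ Submodule.zero_mem _⟩
      · refine ⟨_, hx i hi, ?_⟩
        rw [Projectivization.submodule_mk]
        exact Submodule.mem_span_singleton_self _
    choose p hp hxp using hpoint
    exact ⟨p, hp, (mk_submodule_le_iSup_iff hw).mpr ⟨x, hxp, rfl⟩⟩

theorem one_le_finrank_iff_exists_ne_zero {E : Submodule ℂ V} [FiniteDimensional ℂ E] :
    1 ≤ Module.finrank ℂ E ↔ ∃ u ∈ E, u ≠ 0 := by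
  rw [Nat.one_le_iff_ne_zero, ← pos_iff_ne_zero, Module.finrank_pos_iff,
    Submodule.nontrivial_iff_ne_bot, Submodule.ne_bot_iff]

theorem mem_cone_restrictedSecantPoints {w : ⋀[ℂ]^(k + 2) V} :
    w ∈ cone (restrictedSecantPoints V s 1 (k + 2)) ↔ ∃ (u : V) (v : Fin s → Fin (k + 1) → V),
      ∑ i, exteriorPower.ιMulti ℂ (k + 2) (Matrix.vecCons u (v i)) = w := by
  constructor
  · intro hw
    rcases eq_or_ne w 0 with rfl | hw0
    · exact ⟨0, 0, Finset.sum_eq_zero fun i _ ↦ AlternatingMap.map_coord_zero _ 0 rfl⟩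
    obtain ⟨E, hE, hmeet, hEw⟩ := hw hw0
    obtain ⟨x, hx, rfl⟩ := (mk_submodule_le_iSup_iff hw0).mp hEw
    have := Module.finite_of_finrank_pos hmeet
    obtain ⟨u, hu, hu0⟩ := one_le_finrank_iff_exists_ne_zero.mp hmeet
    have hterm (i : Fin s) : ∃ v : Fin (k + 1) → V,
        exteriorPower.ιMulti ℂ (k + 2) (Matrix.vecCons u v) = x i := by
      obtain ⟨c, v, hv⟩ :=
        exists_smul_ιMulti_vecCons_eq (hE i) ((Submodule.mem_iInf _).mp hu i) hu0 (hx i)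
      obtain ⟨v', hv'⟩ := exists_ιMulti_eq_smul v c
      exact ⟨v', by rw [← hv, ← wedge_ιMulti, hv', map_smul, wedge_ιMulti]⟩
    choose v hv using hterm
    exact ⟨u, v, Finset.sum_congr rfl fun i _ ↦ hv i⟩
  · rintro ⟨u, v, rfl⟩ hw
    obtain ⟨j, -, hj⟩ := Finset.exists_ne_zero_of_sum_ne_zero hw
    have hu0 : u ≠ 0 := fun hu ↦ hj (AlternatingMap.map_coord_zero _ 0 hu)
    have hplane (i : Fin s) : ∃ E : Submodule ℂ V, Module.finrank ℂ E = k + 2 ∧ u ∈ E ∧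
        exteriorPower.ιMulti ℂ (k + 2) (Matrix.vecCons u (v i)) ∈ pluckerLine (k + 2) E := by
      rcases eq_or_ne (exteriorPower.ιMulti ℂ (k + 2) (Matrix.vecCons u (v i))) 0 with hi | hi
      · obtain ⟨E, hE, huE, -⟩ := exists_pluckerLine_eq_span hj
        exact ⟨E, hE, huE 0, hi ▸ Submodule.zero_mem _⟩
      · obtain ⟨E, hE, huE, hEv⟩ := exists_pluckerLine_eq_span hi
        exact ⟨E, hE, huE 0, hEv ▸ Submodule.mem_span_singleton_self _⟩
    choose E hE huE hEv using hplane
    have : FiniteDimensional ℂ (E j) := .of_finrank_pos (hE j ▸ (k + 1).succ_pos)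
    have := Submodule.finiteDimensional_of_le (iInf_le E j)
    exact ⟨E, hE, one_le_finrank_iff_exists_ne_zero.mpr ⟨u, (Submodule.mem_iInf _).mpr huE, hu0⟩,
      (mk_submodule_le_iSup_iff hw).mpr ⟨_, hEv, rfl⟩⟩

end Cones

/-! ## Model elements of the three cones and their line directions -/

section Models

variable {U V : Type*} [AddCommGroup U] [Module ℂ U] [AddCommGroup V] [Module ℂ V] {k s : ℕ}

theorem isImageCone_grassmannian (b : Module.Basis (Fin (k + 1)) ℂ U) :
    IsImageCone (grassmannian V (k + 1)) (exteriorPower.ιMulti ℂ (k + 1) b) := by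
  intro w
  rw [mem_cone_grassmannian]
  constructor
  · rintro ⟨v, rfl⟩
    refine ⟨b.constr ℂ v, ?_⟩
    rw [exteriorPower.map_apply_ιMulti]
    exact congrArg _ (funext fun i ↦ b.constr_basis ℂ v i)
  · rintro ⟨g, rfl⟩
    exact ⟨g ∘ b, (exteriorPower.map_apply_ιMulti ..).symm⟩

theorem isImageCone_restrictedSecantPoints (b : Module.Basis (Fin 5) ℂ U) :
    IsImageCone (restrictedSecantPoints V 2 1 3)
      (wedge₃ (b 0) (b 1) (b 2) + wedge₃ (b 0) (b 3) (b 4)) := by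
  intro w
  rw [mem_cone_restrictedSecantPoints]
  constructor
  · rintro ⟨u, v, rfl⟩
    refine ⟨b.constr ℂ ![u, v 0 0, v 0 1, v 1 0, v 1 1], ?_⟩
    simp only [map_add, map_wedge₃, b.constr_basis, Fin.sum_univ_two]
    congr! 3 <;> ext i <;> fin_cases i <;> rfl
  · rintro ⟨g, rfl⟩
    refine ⟨g (b 0), ![![g (b 1), g (b 2)], ![g (b 3), g (b 4)]], ?_⟩
    simp only [map_add, map_wedge₃, Fin.sum_univ_two, Matrix.cons_val_zero, Matrix.cons_val_one]

theorem isImageCone_secantPoints (b : Module.Basis (Fin 6) ℂ U) :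
    IsImageCone (secantPoints 2 (grassmannian V 3))
      (wedge₃ (b 0) (b 1) (b 2) + wedge₃ (b 3) (b 4) (b 5)) := by
  intro w
  simp only [mem_cone_secantPoints, mem_cone_grassmannian]
  constructor
  · rintro ⟨x, hx, rfl⟩
    choose v hv using hx
    refine ⟨b.constr ℂ ![v 0 0, v 0 1, v 0 2, v 1 0, v 1 1, v 1 2], ?_⟩
    simp only [map_add, map_wedge₃, b.constr_basis, Fin.sum_univ_two, ← hv]
    congr! 3 <;> ext i <;> fin_cases i <;> rfl
  · rintro ⟨g, rfl⟩
    refine ⟨![wedge₃ (g (b 0)) (g (b 1)) (g (b 2)), wedge₃ (g (b 3)) (g (b 4)) (g (b 5))],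
      Fin.forall_fin_two.mpr ⟨⟨_, rfl⟩, ⟨_, rfl⟩⟩, ?_⟩
    simp only [map_add, map_wedge₃, Fin.sum_univ_two, Matrix.cons_val_zero, Matrix.cons_val_one]

variable {ι : Type*} (b : Module.Basis ι ℂ U) {g₀ : U →ₗ[ℂ] V}

theorem apply_mem_lineDirections {c : ι} {ξ : ⋀[ℂ]^k U} {L : V →ₗ[ℂ] ⋀[ℂ]^k V}
    {y : ⋀[ℂ]^k V} (hL : ∀ g : U →ₗ[ℂ] V, (∀ i ≠ c, g (b i) = g₀ (b i)) →
      exteriorPower.map k g ξ = L (g (b c)) + y) (v : V) :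
    L v ∈ lineDirections ξ g₀ := by
  classical
  refine ⟨b.constr ℂ (Pi.single c v), fun t ↦ ?_⟩
  rw [hL _ fun i hi ↦ ?_, hL g₀ fun _ _ ↦ rfl, LinearMap.add_apply, LinearMap.smul_apply,
    b.constr_basis, Pi.single_eq_same, map_add, map_smul, add_right_comm]
  rw [LinearMap.add_apply, LinearMap.smul_apply, b.constr_basis, Pi.single_eq_of_ne hi, smul_zero,
    add_zero]

variable {i j l : ι} {η : ⋀[ℂ]^3 U}

theorem wedge_mem_lineDirections_fst (hj : j ≠ i) (hl : l ≠ i)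
    (hη : ∀ g : U →ₗ[ℂ] V, (∀ m ≠ i, g (b m) = g₀ (b m)) →
      exteriorPower.map 3 g η = exteriorPower.map 3 g₀ η) (v : V) :
    wedge v (wedge₂ (g₀ (b j)) (g₀ (b l))) ∈
      lineDirections (wedge₃ (b i) (b j) (b l) + η) g₀ := by
  refine apply_mem_lineDirections b (c := i) (L := wedge.flip (wedge₂ (g₀ (b j)) (g₀ (b l))))
    (y := exteriorPower.map 3 g₀ η) (fun g hg ↦ ?_) v
  rw [LinearMap.flip_apply, wedge_wedge₂, map_add, map_wedge₃, hg j hj, hg l hl, hη g hg]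

theorem wedge_mem_lineDirections_thd (hi : i ≠ l) (hj : j ≠ l)
    (hη : ∀ g : U →ₗ[ℂ] V, (∀ m ≠ l, g (b m) = g₀ (b m)) →
      exteriorPower.map 3 g η = exteriorPower.map 3 g₀ η) (v : V) :
    wedge v (wedge₂ (g₀ (b i)) (g₀ (b j))) ∈
      lineDirections (wedge₃ (b i) (b j) (b l) + η) g₀ := by
  rw [wedge₃_rotate]
  exact wedge_mem_lineDirections_fst b hi hj hη v

theorem wedge_mem_lineDirections_snd (hi : i ≠ j) (hl : l ≠ j)
    (hη : ∀ g : U →ₗ[ℂ] V, (∀ m ≠ j, g (b m) = g₀ (b m)) →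
      exteriorPower.map 3 g η = exteriorPower.map 3 g₀ η) (v : V) :
    wedge v (wedge₂ (g₀ (b i)) (g₀ (b l))) ∈
      lineDirections (wedge₃ (b i) (b j) (b l) + η) g₀ := by
  have h := wedge_mem_lineDirections_fst b hl hi hη (-v)
  rwa [wedge₃_rotate (b i), map_neg, LinearMap.neg_apply, wedge_wedge₂, ← wedge₃_swap₂₃,
    ← wedge_wedge₂] at h

theorem exteriorPower_map_wedge₃_congr {m : ι} (hi : i ≠ m) (hj : j ≠ m) (hl : l ≠ m)
    {g : U →ₗ[ℂ] V} (hg : ∀ i ≠ m, g (b i) = g₀ (b i)) :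
    exteriorPower.map 3 g (wedge₃ (b i) (b j) (b l)) =
      exteriorPower.map 3 g₀ (wedge₃ (b i) (b j) (b l)) := by
  rw [map_wedge₃, map_wedge₃, hg i hi, hg j hj, hg l hl]

theorem dot_le_span_lineDirections_triple (hij : i ≠ j) (hil : i ≠ l) (hjl : j ≠ l)
    (hη : ∀ m ∈ ({i, j, l} : Set ι), ∀ g : U →ₗ[ℂ] V, (∀ m' ≠ m, g (b m') = g₀ (b m')) →
      exteriorPower.map 3 g η = exteriorPower.map 3 g₀ η) :
    dot {wedge₂ (g₀ (b i)) (g₀ (b j)), wedge₂ (g₀ (b i)) (g₀ (b l)),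
      wedge₂ (g₀ (b j)) (g₀ (b l))} ≤
        Submodule.span ℂ (lineDirections (wedge₃ (b i) (b j) (b l) + η) g₀) := by
  refine dot_le.mpr fun w hw v ↦ Submodule.subset_span ?_
  rcases hw with rfl | rfl | rfl
  · exact wedge_mem_lineDirections_thd b hil hjl (hη l (by simp)) v
  · exact wedge_mem_lineDirections_snd b hij hjl.symm (hη j (by simp)) v
  · exact wedge_mem_lineDirections_fst b hij.symm hil.symm (hη i (by simp)) v

theorem dot_le_span_lineDirections_grassmannian (b : Module.Basis (Fin 3) ℂ U) :
    dot {wedge₂ (g₀ (b 0)) (g₀ (b 1)), wedge₂ (g₀ (b 0)) (g₀ (b 2)),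
      wedge₂ (g₀ (b 1)) (g₀ (b 2))} ≤
        Submodule.span ℂ (lineDirections (wedge₃ (b 0) (b 1) (b 2)) g₀) := by
  have h := dot_le_span_lineDirections_triple b (g₀ := g₀) (i := 0) (j := 1) (l := 2) (η := 0)
    (by decide) (by decide) (by decide) (fun _ _ g _ ↦ by rw [map_zero, map_zero])
  rwa [add_zero] at h

theorem dot_le_span_lineDirections_restrictedSecantPoints (b : Module.Basis (Fin 5) ℂ U) :
    dot {wedge₂ (g₀ (b 1)) (g₀ (b 2)) + wedge₂ (g₀ (b 3)) (g₀ (b 4)),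
      wedge₂ (g₀ (b 0)) (g₀ (b 1)), wedge₂ (g₀ (b 0)) (g₀ (b 2)),
      wedge₂ (g₀ (b 0)) (g₀ (b 3)), wedge₂ (g₀ (b 0)) (g₀ (b 4))} ≤
        Submodule.span ℂ
          (lineDirections (wedge₃ (b 0) (b 1) (b 2) + wedge₃ (b 0) (b 3) (b 4)) g₀) := by
  refine dot_le.mpr fun w hw v ↦ Submodule.subset_span ?_
  rcases hw with rfl | rfl | rfl | rfl | rfl
  · refine apply_mem_lineDirections b (c := 0) (L := wedge.flip _) (y := 0) (fun g hg ↦ ?_) v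
    rw [LinearMap.flip_apply, map_add, map_add, wedge_wedge₂, wedge_wedge₂, map_wedge₃, map_wedge₃,
      hg 1 (by decide), hg 2 (by decide), hg 3 (by decide), hg 4 (by decide), add_zero]
  · exact wedge_mem_lineDirections_thd b (by decide) (by decide)
      (fun _ ↦ exteriorPower_map_wedge₃_congr b (by decide) (by decide) (by decide)) v
  · exact wedge_mem_lineDirections_snd b (by decide) (by decide)
      (fun _ ↦ exteriorPower_map_wedge₃_congr b (by decide) (by decide) (by decide)) v
  · rw [add_comm (wedge₃ _ _ _)]
    exact wedge_mem_lineDirections_thd b (by decide) (by decide)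
      (fun _ ↦ exteriorPower_map_wedge₃_congr b (by decide) (by decide) (by decide)) v
  · rw [add_comm (wedge₃ _ _ _)]
    exact wedge_mem_lineDirections_snd b (by decide) (by decide)
      (fun _ ↦ exteriorPower_map_wedge₃_congr b (by decide) (by decide) (by decide)) v

theorem dot_le_span_lineDirections_secantPoints (b : Module.Basis (Fin 6) ℂ U) :
    dot {wedge₂ (g₀ (b 0)) (g₀ (b 1)), wedge₂ (g₀ (b 0)) (g₀ (b 2)),
      wedge₂ (g₀ (b 1)) (g₀ (b 2)), wedge₂ (g₀ (b 3)) (g₀ (b 4)), wedge₂ (g₀ (b 3)) (g₀ (b 5)),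
      wedge₂ (g₀ (b 4)) (g₀ (b 5))} ≤
        Submodule.span ℂ
          (lineDirections (wedge₃ (b 0) (b 1) (b 2) + wedge₃ (b 3) (b 4) (b 5)) g₀) := by
  have h₁ := dot_le_span_lineDirections_triple b (g₀ := g₀) (i := 0) (j := 1) (l := 2)
    (η := wedge₃ (b 3) (b 4) (b 5)) (by decide) (by decide) (by decide) (fun m hm g ↦ by
      rcases hm with rfl | rfl | rfl <;>
        exact exteriorPower_map_wedge₃_congr b (by decide) (by decide) (by decide))
  have h₂ := dot_le_span_lineDirections_triple b (g₀ := g₀) (i := 3) (j := 4) (l := 5)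
    (η := wedge₃ (b 0) (b 1) (b 2)) (by decide) (by decide) (by decide) (fun m hm g ↦ by
      rcases hm with rfl | rfl | rfl <;>
        exact exteriorPower_map_wedge₃_congr b (by decide) (by decide) (by decide))
  rw [add_comm (wedge₃ _ _ _)] at h₂
  refine Eq.trans_le ?_ (sup_le h₁ h₂)
  rw [← dot_union, Set.insert_union, Set.insert_union, Set.singleton_union]

end Models

section Inclusion

variable {V : Type*} [AddCommGroup V] [Module ℂ V] {k s : ℕ}

theorem restrictedSecantPoints_subset_secantPoints :
    restrictedSecantPoints V s 1 (k + 2) ⊆ secantPoints s (grassmannian V (k + 2)) := by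
  refine subset_of_cone_subset fun w hw ↦ ?_
  obtain ⟨u, v, rfl⟩ := mem_cone_restrictedSecantPoints.mp hw
  exact mem_cone_secantPoints.mpr ⟨_, fun i ↦ mem_cone_grassmannian.mpr ⟨_, rfl⟩, rfl⟩

theorem restrictedSecant_subset_secantVariety :
    restrictedSecant V s 1 (k + 2) ⊆ secantVariety s (grassmannian V (k + 2)) :=
  zariskiClosure_mono restrictedSecantPoints_subset_secantPoints

theorem secantPoints_two_subset_restrictedSecantPoints [FiniteDimensional ℂ V] {r : ℕ}
    (hV : Module.finrank ℂ V + r ≤ 2 * k) :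
    secantPoints 2 (grassmannian V k) ⊆ restrictedSecantPoints V 2 r k := by
  rintro p ⟨x, hx, hp⟩
  choose E hE hxE using hx
  refine ⟨E, hE, ?_, by simpa only [hxE] using hp⟩
  have hsum := Submodule.finrank_sup_add_finrank_inf_eq (E 0) (E 1)
  have hsup := (E 0 ⊔ E 1).finrank_le
  have hinf : Module.finrank ℂ (E 0 ⊓ E 1 : Submodule ℂ V) ≤ Module.finrank ℂ ↥(⨅ i, E i) :=
    Submodule.finrank_mono (le_iInf (Fin.forall_fin_two.mpr ⟨inf_le_left, inf_le_right⟩))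
  rw [hE, hE] at hsum
  omega

theorem restrictedSecant_two_eq_secantVariety [FiniteDimensional ℂ V]
    (hV : Module.finrank ℂ V + 1 ≤ 2 * (k + 2)) :
    restrictedSecant V 2 1 (k + 2) = secantVariety 2 (grassmannian V (k + 2)) :=
  restrictedSecant_subset_secantVariety.antisymm
    (zariskiClosure_mono (secantPoints_two_subset_restrictedSecantPoints hV))

end Inclusion

/-! ## Affine tangent spaces of `Gr(3, V)` -/

section Trivectors

variable {U V : Type*} [AddCommGroup U] [Module ℂ U] [AddCommGroup V] [Module ℂ V]

/-- The linear form `φ ∧ ψ ∧ χ` on `⋀³ V`. -/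
def wedgeDual (φ ψ χ : Module.Dual ℂ V) : Module.Dual ℂ (⋀[ℂ]^3 V) :=
  exteriorPower.pairingDual ℂ V 3 (wedge₃ φ ψ χ)

theorem wedgeDual_wedge₃ (φ ψ χ : Module.Dual ℂ V) (a b c : V) :
    wedgeDual φ ψ χ (wedge₃ a b c) = φ a * (ψ b * χ c - ψ c * χ b)
      - φ b * (ψ a * χ c - ψ c * χ a) + φ c * (ψ a * χ b - ψ b * χ a) := by
  rw [wedgeDual, exteriorPower.pairingDual_ιMulti_ιMulti, Matrix.det_fin_three]
  simp only [Matrix.of_apply, Matrix.cons_val]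
  ring

theorem wedgeDual_rotate (φ ψ χ : Module.Dual ℂ V) : wedgeDual ψ χ φ = wedgeDual φ ψ χ := by
  rw [wedgeDual, wedge₃_rotate, wedgeDual]

theorem wedgeDual_eq_zero_of_mem_dot {a b c : V} {φ ψ : Module.Dual ℂ V}
    (hφ : φ a = 0 ∧ φ b = 0 ∧ φ c = 0) (hψ : ψ a = 0 ∧ ψ b = 0 ∧ ψ c = 0) (χ : Module.Dual ℂ V)
    {w : ⋀[ℂ]^3 V} (hw : w ∈ dot {wedge₂ a b, wedge₂ a c, wedge₂ b c}) :
    wedgeDual φ ψ χ w = 0 := by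
  obtain ⟨hφa, hφb, hφc⟩ := hφ
  obtain ⟨hψa, hψb, hψc⟩ := hψ
  have hle : dot {wedge₂ a b, wedge₂ a c, wedge₂ b c} ≤ LinearMap.ker (wedgeDual φ ψ χ) := by
    refine dot_le.mpr fun w hw v ↦ ?_
    rcases hw with rfl | rfl | rfl <;>
      rw [LinearMap.mem_ker, wedge_wedge₂, wedgeDual_wedge₃] <;>
      simp only [hφa, hφb, hφc, hψa, hψb, hψc] <;> ring
  exact hle hw

theorem eq_zero_of_wedge_add_wedge_add_wedge_eq_zero (b : Module.Basis (Fin 3) ℂ U)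
    {g : U →ₗ[ℂ] V} {p : V →ₗ[ℂ] U} (hp : p ∘ₗ g = .id) {t : ℂ} {x y z : V} (hx : p x = 0)
    (hy : p y = 0) (hz : p z = 0)
    (h : wedge (t • g (b 0) + x) (wedge₂ (g (b 1)) (g (b 2))) +
      wedge y (wedge₂ (g (b 0)) (g (b 2))) + wedge z (wedge₂ (g (b 0)) (g (b 1))) = 0) :
    (t = 0 ∧ x = 0) ∧ y = 0 ∧ z = 0 := by
  have hpg (u : U) : p (g u) = u := LinearMap.congr_fun hp u
  simp only [wedge_wedge₂] at h
  have hpairing (φ : Module.Dual ℂ V) (i j : Fin 3) :=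
    congrArg (wedgeDual φ (b.coord i ∘ₗ p) (b.coord j ∘ₗ p)) h
  simp only [map_add, wedgeDual_wedge₃, LinearMap.comp_apply, map_smul, hpg, hx, hy,
    hz, b.coord_apply, b.repr_self, Finsupp.single_apply, map_zero] at hpairing
  have hu : t • g (b 0) + x = 0 := (Module.forall_dual_apply_eq_zero_iff ℂ _).mp fun φ ↦ by
    simpa using hpairing φ 1 2
  have ht : t = 0 := by simpa [hpg, hx] using congrArg (fun u ↦ b.coord 0 (p u)) hu
  have hx0 : x = 0 := by rwa [ht, zero_smul, zero_add] at hu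
  refine ⟨⟨ht, hx0⟩, (Module.forall_dual_apply_eq_zero_iff ℂ _).mp fun φ ↦ ?_,
    (Module.forall_dual_apply_eq_zero_iff ℂ _).mp fun φ ↦ ?_⟩
  · simpa [ht, hx0] using hpairing φ 0 2
  · simpa [ht, hx0] using hpairing φ 0 1

/-- The tangent space `⋀²A ∧ V` of the Grassmannian at a plane `A` contains
`⋀³A ⊕ (⋀²A ⊗ K)` for a complement `K` of `A`. -/
theorem chartDim_le_finrank_dot_triple [FiniteDimensional ℂ V] (b : Module.Basis (Fin 3) ℂ U)
    {g : U →ₗ[ℂ] V} (hg : Function.Injective g) :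
    chartDim U V 3 ≤ Module.finrank ℂ (dot {wedge₂ (g (b 0)) (g (b 1)),
      wedge₂ (g (b 0)) (g (b 2)), wedge₂ (g (b 1)) (g (b 2))}) := by
  obtain ⟨p, hp⟩ := g.exists_leftInverse_of_injective (LinearMap.ker_eq_bot.mpr hg)
  let K := LinearMap.ker p
  let Φ : (ℂ × K) × K × K →ₗ[ℂ] ⋀[ℂ]^3 V :=
    (wedge.flip (wedge₂ (g (b 1)) (g (b 2))) ∘ₗ
      (LinearMap.toSpanSingleton ℂ V (g (b 0))).coprod K.subtype).coprod
    ((wedge.flip (wedge₂ (g (b 0)) (g (b 2))) ∘ₗ K.subtype).coprod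
      (wedge.flip (wedge₂ (g (b 0)) (g (b 1))) ∘ₗ K.subtype))
  have hΦ : Function.Injective Φ := by
    rw [← LinearMap.ker_eq_bot, LinearMap.ker_eq_bot']
    rintro ⟨⟨t, x⟩, y, z⟩ h
    obtain ⟨⟨ht, hx⟩, hy, hz⟩ := eq_zero_of_wedge_add_wedge_add_wedge_eq_zero b hp x.2 y.2 z.2
      ((add_assoc _ _ _).trans h)
    exact Prod.ext (Prod.ext ht (Subtype.ext hx)) (Prod.ext (Subtype.ext hy) (Subtype.ext hz))
  have hrange : LinearMap.range Φ ≤ dot {wedge₂ (g (b 0)) (g (b 1)),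
      wedge₂ (g (b 0)) (g (b 2)), wedge₂ (g (b 1)) (g (b 2))} := by
    rintro _ ⟨⟨⟨t, x⟩, y, z⟩, rfl⟩
    exact add_mem (wedge_mem_dot (by simp) _)
      (add_mem (wedge_mem_dot (by simp) _) (wedge_mem_dot (by simp) _))
  calc chartDim U V 3 = Module.finrank ℂ ((ℂ × K) × K × K) := by
        have hK : Module.finrank ℂ K = _ := finrank_ker_of_comp_eq_id hp
        have hU : Module.finrank ℂ U = 3 := Module.finrank_eq_card_basis b
        simp only [chartDim, Module.finrank_prod, Module.finrank_self, hU, hK, Nat.choose_self]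
        ring
    _ = Module.finrank ℂ (LinearMap.range Φ) := (LinearMap.finrank_range_of_inj hΦ).symm
    _ ≤ _ := Submodule.finrank_mono hrange

end Trivectors

/-! ## The subspaces of the theorem in coordinates -/

section Coordinates

variable {V : Type*} [AddCommGroup V] [Module ℂ V] {n : ℕ} (e : Module.Basis (Fin n) ℂ V)

/-- `V · {e_p e_q, e_p e_s, e_q e_s}`, the space `T̂_{pqs}` of the theorem. -/
abbrev dotTriple (p q s : ℕ) : Submodule ℂ (⋀[ℂ]^3 V) := dot {e2 e p q, e2 e p s, e2 e q s}

/-- `V · {e₂e₃ + e₄e₅, e₁e₂, e₁e₃, e₁e₄, e₁e₅}`, the tangent space of the restricted chordal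
variety at `e₁e₂e₃ + e₁e₄e₅`. -/
abbrev dotFive : Submodule ℂ (⋀[ℂ]^3 V) :=
  dot {e2 e 2 3 + e2 e 4 5, e2 e 1 2, e2 e 1 3, e2 e 1 4, e2 e 1 5}

/-- `V · {e₁e₂, e₁e₃, e₂e₃, e₄e₅, e₄e₆, e₅e₆}`, the tangent space of the chordal variety at
`e₁e₂e₃ + e₄e₅e₆`. -/
abbrev dotSix : Submodule ℂ (⋀[ℂ]^3 V) :=
  dot {e2 e 1 2, e2 e 1 3, e2 e 2 3, e2 e 4 5, e2 e 4 6, e2 e 5 6}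

/-- The span of `e₁e₂e₄`, `e₁e₂e₅`, `e₁e₃e₄`, `e₁e₃e₅`, which is `T̂₁₂₃ ∩ T̂₁₄₅`. -/
abbrev meetSpan : Submodule ℂ (⋀[ℂ]^3 V) :=
  Submodule.span ℂ {e3 e 1 2 4, e3 e 1 2 5, e3 e 1 3 4, e3 e 1 3 5}

/-- The coordinate forms of a basis, numbered from `1` (and `0` for any other index). -/
def covec (i : ℕ) : Module.Dual ℂ V :=
  if h : 1 ≤ i ∧ i ≤ n then e.coord ⟨i - 1, by omega⟩ else 0

theorem vec_succ (i : Fin n) : vec e (i + 1) = e i := dif_pos ⟨i.1.succ_pos, i.2⟩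

theorem covec_succ (i : Fin n) : covec e (i + 1) = e.coord i := dif_pos ⟨i.1.succ_pos, i.2⟩

theorem covec_vec (i j : ℕ) : covec e i (vec e j) = if i = j ∧ 1 ≤ i ∧ i ≤ n then 1 else 0 := by
  unfold covec vec
  by_cases hi : 1 ≤ i ∧ i ≤ n
  · by_cases hj : 1 ≤ j ∧ j ≤ n
    · rw [dif_pos hi, dif_pos hj, Module.Basis.coord_apply, Module.Basis.repr_self,
        Finsupp.single_apply]
      congr 1
      rw [Fin.mk.injEq, eq_iff_iff]
      omega
    · rw [dif_neg hj, map_zero, if_neg (by omega)]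
  · rw [dif_neg hi, LinearMap.zero_apply, if_neg (by tauto)]

theorem covec_vec_of_ne {i j : ℕ} (h : i ≠ j) : covec e i (vec e j) = 0 := by
  rw [covec_vec, if_neg fun hij ↦ h hij.1]

theorem linearIndependent_vec {ι : Type*} {f : ι → ℕ} (hf : Function.Injective f)
    (hfn : ∀ i, 1 ≤ f i ∧ f i ≤ n) : LinearIndependent ℂ fun i ↦ vec e (f i) := by
  have hvec (i : ι) : vec e (f i) = e ⟨f i - 1, by have := hfn i; omega⟩ := dif_pos (hfn i)
  simp only [hvec]
  refine e.linearIndependent.comp (fun i ↦ ⟨f i - 1, _⟩) fun i j hij ↦ hf ?_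
  have := Fin.mk.inj hij
  have := hfn i
  have := hfn j
  omega

/-- The Plücker coordinates on `⋀³ V`. -/
def plucker (i j k : ℕ) : Module.Dual ℂ (⋀[ℂ]^3 V) :=
  wedgeDual (covec e i) (covec e j) (covec e k)

/-- A trivector is the sum of its Plücker coordinates times the products of basis vectors. -/
theorem mem_of_forall_plucker_eq_zero_or {N : Submodule ℂ (⋀[ℂ]^3 V)} {w : ⋀[ℂ]^3 V}
    (h : ∀ i j k, 1 ≤ i → i < j → j < k → k ≤ n → plucker e i j k w = 0 ∨ e3 e i j k ∈ N) :
    w ∈ N := by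
  rw [← (e.exteriorPower 3).sum_repr w]
  refine Submodule.sum_mem _ fun s _ ↦ ?_
  let f := Set.powersetCard.ofFinEmbEquiv.symm s
  have hlt {a b : Fin 3} (hab : a < b) : (f a : ℕ) + 1 < f b + 1 :=
    Nat.succ_lt_succ (f.strictMono hab)
  rcases h (f 0 + 1) (f 1 + 1) (f 2 + 1) (by omega) (hlt (by decide)) (hlt (by decide))
    (f 2).isLt with hzero | hmem
  · have hrepr : (e.exteriorPower 3).repr w s = 0 := by
      rw [exteriorPower.basis_repr_apply, exteriorPower.ιMultiDual,
        exteriorPower.ιMulti_family, ιMulti_eq_wedge₃]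
      rwa [plucker, covec_succ, covec_succ, covec_succ] at hzero
    rw [hrepr, zero_smul]
    exact N.zero_mem
  · refine N.smul_mem _ ?_
    rw [exteriorPower.basis_apply, exteriorPower.ιMulti_family, ιMulti_eq_wedge₃]
    rwa [e3, vec_succ, vec_succ, vec_succ] at hmem

theorem plucker_eq_zero_of_mem_dotTriple {p q s : ℕ} {w : ⋀[ℂ]^3 V} (hw : w ∈ dotTriple e p q s)
    {i j k : ℕ} (h : (i ∉ ({p, q, s} : Set ℕ) ∧ j ∉ ({p, q, s} : Set ℕ)) ∨
      (i ∉ ({p, q, s} : Set ℕ) ∧ k ∉ ({p, q, s} : Set ℕ)) ∨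
      (j ∉ ({p, q, s} : Set ℕ) ∧ k ∉ ({p, q, s} : Set ℕ))) :
    plucker e i j k w = 0 := by
  have hcovec {i : ℕ} (hi : i ∉ ({p, q, s} : Set ℕ)) :
      covec e i (vec e p) = 0 ∧ covec e i (vec e q) = 0 ∧ covec e i (vec e s) = 0 :=
    ⟨covec_vec_of_ne e fun h ↦ hi (by simp [h]), covec_vec_of_ne e fun h ↦ hi (by simp [h]),
      covec_vec_of_ne e fun h ↦ hi (by simp [h])⟩
  rw [plucker]
  rcases h with ⟨hi, hj⟩ | ⟨hi, hk⟩ | ⟨hj, hk⟩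
  · exact wedgeDual_eq_zero_of_mem_dot (hcovec hi) (hcovec hj) _ hw
  · rw [← wedgeDual_rotate, ← wedgeDual_rotate]
    exact wedgeDual_eq_zero_of_mem_dot (hcovec hk) (hcovec hi) _ hw
  · rw [← wedgeDual_rotate]
    exact wedgeDual_eq_zero_of_mem_dot (hcovec hj) (hcovec hk) _ hw

theorem dotTriple_inf_dotTriple : dotTriple e 1 2 3 ⊓ dotTriple e 1 4 5 = meetSpan e := by
  apply le_antisymm
  · rintro w ⟨h₁₂₃, h₁₄₅⟩
    refine mem_of_forall_plucker_eq_zero_or e fun i j k hi hij hjk _ ↦ ?_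
    by_cases hijk : i = 1 ∧ (j = 2 ∨ j = 3) ∧ (k = 4 ∨ k = 5)
    · obtain ⟨rfl, rfl | rfl, rfl | rfl⟩ := hijk <;>
        exact .inr (Submodule.subset_span (by simp))
    · refine .inl ?_
      by_cases hj : j ≤ 3
      · refine plucker_eq_zero_of_mem_dotTriple e h₁₄₅ ?_
        simp only [Set.mem_insert_iff, Set.mem_singleton_iff]
        omega
      · refine plucker_eq_zero_of_mem_dotTriple e h₁₂₃ ?_
        simp only [Set.mem_insert_iff, Set.mem_singleton_iff]
        omega
  · refine Submodule.span_le.mpr ?_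
    rintro _ (rfl | rfl | rfl | rfl) <;>
      exact ⟨wedge₃_mem_dot_thd (by simp [e2]) _, wedge₃_mem_dot_snd (by simp [e2]) _⟩

theorem dotTriple_inf_eq_bot : dotTriple e 1 2 3 ⊓ dotTriple e 4 5 6 = ⊥ := by
  rw [eq_bot_iff]
  rintro w ⟨h₁₂₃, h₄₅₆⟩
  refine mem_of_forall_plucker_eq_zero_or e fun i j k _ hij hjk _ ↦ .inl ?_
  by_cases hj : j ≤ 3
  · refine plucker_eq_zero_of_mem_dotTriple e h₄₅₆ ?_
    simp only [Set.mem_insert_iff, Set.mem_singleton_iff]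
    omega
  · refine plucker_eq_zero_of_mem_dotTriple e h₁₂₃ ?_
    simp only [Set.mem_insert_iff, Set.mem_singleton_iff]
    omega

theorem linearIndependent_meet (hn : 5 ≤ n) :
    LinearIndependent ℂ ![e3 e 1 2 4, e3 e 1 2 5, e3 e 1 3 4, e3 e 1 3 5] := by
  have hn' : n ≠ 0 ∧ 2 ≤ n ∧ 3 ≤ n ∧ 4 ≤ n := by omega
  refine LinearIndependent.of_pairwise_dual_eq_zero_one _
    ![plucker e 1 2 4, plucker e 1 2 5, plucker e 1 3 4, plucker e 1 3 5]
    (fun i j hij ↦ ?_) (fun i ↦ ?_)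
  · fin_cases i <;> fin_cases j <;> first
      | exact absurd rfl hij
      | simp [plucker, e3, wedgeDual_wedge₃, covec_vec]
  · fin_cases i <;> simp [plucker, e3, wedgeDual_wedge₃, covec_vec, Nat.one_le_iff_ne_zero, hn, hn']

theorem dotSix_eq_sup : dotSix e = dotTriple e 1 2 3 ⊔ dotTriple e 4 5 6 := by
  rw [← dot_union, Set.insert_union, Set.insert_union, Set.singleton_union]

theorem wedge_e2 (i j k : ℕ) : wedge (vec e i) (e2 e j k) = e3 e i j k :=
  wedge_wedge₂ _ _ _

theorem e3_self₁₂ (i j : ℕ) : e3 e i i j = 0 :=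
  AlternatingMap.map_eq_zero_of_eq _ _ (i := 0) (j := 1) rfl (by decide)

theorem e3_self₁₃ (i j : ℕ) : e3 e i j i = 0 :=
  AlternatingMap.map_eq_zero_of_eq _ _ (i := 0) (j := 2) rfl (by decide)

theorem e3_two_three_mem {k : ℕ} (hk : 1 ≤ k) (hkn : k ≤ n) :
    e3 e k 2 3 ∈ dotFive e ⊔ extraSpan e := by
  have hsum : e3 e k 2 3 + e3 e k 4 5 ∈ dotFive e := by
    rw [← wedge_e2, ← wedge_e2, ← map_add]
    exact wedge_mem_dot (Set.mem_insert _ _) _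
  rcases (by omega : k = 1 ∨ k = 2 ∨ k = 3 ∨ k = 4 ∨ k = 5 ∨ 6 ≤ k) with
    rfl | rfl | rfl | rfl | rfl | hk6
  · exact Submodule.mem_sup_left (wedge₃_mem_dot_thd (by simp [e2]) _)
  · exact e3_self₁₂ e 2 3 ▸ zero_mem _
  · exact e3_self₁₃ e 3 2 ▸ zero_mem _
  · rw [e3_self₁₂ e 4 5, add_zero] at hsum
    exact Submodule.mem_sup_left hsum
  · rw [e3_self₁₃ e 5 4, add_zero] at hsum
    exact Submodule.mem_sup_left hsum
  · have hdiff : e3 e k 2 3 - e3 e k 4 5 ∈ extraSpan e :=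
      Submodule.subset_span ⟨k, hk6, hkn, rfl⟩
    have hhalf : e3 e k 2 3 = (1 / 2 : ℂ) • ((e3 e k 2 3 + e3 e k 4 5) +
      (e3 e k 2 3 - e3 e k 4 5)) := by module
    rw [hhalf]
    exact Submodule.smul_mem _ _ (Submodule.add_mem_sup hsum hdiff)

theorem wedge_two_three_mem (v : V) : wedge v (e2 e 2 3) ∈ dotFive e ⊔ extraSpan e := by
  suffices h : (⊤ : Submodule ℂ V) ≤ (dotFive e ⊔ extraSpan e).comap (wedge.flip (e2 e 2 3)) from
    h Submodule.mem_top
  rw [← e.span_eq, Submodule.span_le]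
  rintro _ ⟨i, rfl⟩
  rw [SetLike.mem_coe, Submodule.mem_comap, LinearMap.flip_apply, ← vec_succ, wedge_e2]
  exact e3_two_three_mem e i.1.succ_pos i.2

theorem dotTriple_sup_dotTriple :
    dotTriple e 1 2 3 ⊔ dotTriple e 1 4 5 = dotFive e ⊔ extraSpan e := by
  have hfive {w : ⋀[ℂ]^2 V}
      (hw : w ∈ ({e2 e 2 3 + e2 e 4 5, e2 e 1 2, e2 e 1 3, e2 e 1 4, e2 e 1 5} : Set (⋀[ℂ]^2 V)))
      (v : V) : wedge v w ∈ dotFive e ⊔ extraSpan e :=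
    Submodule.mem_sup_left (wedge_mem_dot hw v)
  refine le_antisymm (sup_le (dot_le.mpr ?_) (dot_le.mpr ?_)) (sup_le (dot_le.mpr ?_) ?_)
  · rintro _ (rfl | rfl | rfl) v
    exacts [hfive (by simp) v, hfive (by simp) v, wedge_two_three_mem e v]
  · rintro _ (rfl | rfl | rfl) v
    · exact hfive (by simp) v
    · exact hfive (by simp) v
    · rw [← add_sub_cancel_left (e2 e 2 3) (e2 e 4 5), map_sub]
      exact sub_mem (hfive (by simp) v) (wedge_two_three_mem e v)
  · have h₁₂₃ {w : ⋀[ℂ]^2 V} (hw : w ∈ ({e2 e 1 2, e2 e 1 3, e2 e 2 3} : Set (⋀[ℂ]^2 V))) (v : V) :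
        wedge v w ∈ dotTriple e 1 2 3 ⊔ dotTriple e 1 4 5 :=
      Submodule.mem_sup_left (wedge_mem_dot hw v)
    have h₁₄₅ {w : ⋀[ℂ]^2 V} (hw : w ∈ ({e2 e 1 4, e2 e 1 5, e2 e 4 5} : Set (⋀[ℂ]^2 V))) (v : V) :
        wedge v w ∈ dotTriple e 1 2 3 ⊔ dotTriple e 1 4 5 :=
      Submodule.mem_sup_right (wedge_mem_dot hw v)
    rintro _ (rfl | rfl | rfl | rfl | rfl) v
    · rw [map_add]
      exact add_mem (h₁₂₃ (by simp) v) (h₁₄₅ (by simp) v)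
    exacts [h₁₂₃ (by simp) v, h₁₂₃ (by simp) v, h₁₄₅ (by simp) v, h₁₄₅ (by simp) v]
  · refine Submodule.span_le.mpr ?_
    rintro _ ⟨i, -, -, rfl⟩
    exact sub_mem (Submodule.mem_sup_left (wedge₃_mem_dot_fst (by simp [e2]) _))
      (Submodule.mem_sup_right (wedge₃_mem_dot_fst (by simp [e2]) _))

end Coordinates

/-! ## Dimensions and tangent spaces in coordinates -/

section Frames

variable {V : Type*} [AddCommGroup V] [Module ℂ V] {n m : ℕ} (e : Module.Basis (Fin n) ℂ V)

/-- The standard basis of `ℂ^m`. -/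
abbrev stdBasis (m : ℕ) : Module.Basis (Fin m) ℂ (Fin m → ℂ) := Pi.basisFun ℂ (Fin m)

/-- The linear map `ℂ^m → V` that sends the standard basis to `e_{f 0}, …, e_{f (m - 1)}`. -/
def frame (f : Fin m → ℕ) : (Fin m → ℂ) →ₗ[ℂ] V :=
  (stdBasis m).constr ℂ fun i ↦ vec e (f i)

theorem frame_stdBasis (f : Fin m → ℕ) (i : Fin m) : frame e f (stdBasis m i) = vec e (f i) :=
  (stdBasis m).constr_basis ℂ _ i

theorem injective_frame {f : Fin m → ℕ} (hf : StrictMono f) (hfn : ∀ i, 1 ≤ f i ∧ f i ≤ n) :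
    Function.Injective (frame e f) :=
  (stdBasis m).injective_constr_of_linearIndependent
    (linearIndependent_vec e hf.injective hfn)

/-- The frame `e₁, …, e_m`. -/
abbrev initialFrame (m : ℕ) : (Fin m → ℂ) →ₗ[ℂ] V := frame e fun i ↦ (i : ℕ) + 1

theorem injective_initialFrame (hm : m ≤ n) : Function.Injective (initialFrame e m) :=
  injective_frame e (Fin.val_strictMono.add_const 1) fun i ↦ ⟨by omega, by omega⟩

include e in
theorem chartDim_fin_fun (m k : ℕ) :
    chartDim (Fin m → ℂ) V k = m.choose k + m * (n - m) := by
  rw [chartDim, Module.finrank_fin_fun, Module.finrank_eq_card_basis e, Fintype.card_fin]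

section Grassmannian

variable {p q s : ℕ}

theorem dotTriple_le_span_lineDirections :
    dotTriple e p q s ≤ Submodule.span ℂ (lineDirections
      (exteriorPower.ιMulti ℂ 3 (stdBasis 3)) (frame e ![p, q, s])) := by
  have h := dot_le_span_lineDirections_grassmannian (g₀ := frame e ![p, q, s]) (stdBasis 3)
  simp only [frame_stdBasis] at h
  exact ιMulti_eq_wedge₃ (stdBasis 3) ▸ h

theorem map_frame_three : exteriorPower.map 3 (frame e ![p, q, s])
    (exteriorPower.ιMulti ℂ 3 (stdBasis 3)) = e3 e p q s := by
  rw [ιMulti_eq_wedge₃, map_wedge₃, frame_stdBasis, frame_stdBasis, frame_stdBasis]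
  rfl

variable (hp : 1 ≤ p) (hpq : p < q) (hqs : q < s) (hsn : s ≤ n)
include hp hpq hqs hsn

theorem injective_frame_three : Function.Injective (frame e ![p, q, s]) := by
  refine injective_frame e (Fin.strictMono_iff_lt_succ.mpr fun i ↦ ?_) fun i ↦ ?_
  · fin_cases i
    exacts [hpq, hqs]
  · fin_cases i
    exacts [⟨hp, (hpq.trans hqs).le.trans hsn⟩, ⟨hp.trans hpq.le, hqs.le.trans hsn⟩,
      ⟨hp.trans (hpq.trans hqs).le, hsn⟩]

theorem chartDim_le_finrank_dotTriple :
    chartDim (Fin 3 → ℂ) V 3 ≤ Module.finrank ℂ (dotTriple e p q s) := by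
  have : FiniteDimensional ℂ V := Module.Basis.finiteDimensional_of_finite e
  have h := chartDim_le_finrank_dot_triple (stdBasis 3)
    (injective_frame_three e hp hpq hqs hsn)
  rwa [frame_stdBasis, frame_stdBasis, frame_stdBasis] at h

theorem coneTangentSpace_grassmannian :
    coneTangentSpace (grassmannian V 3) (e3 e p q s) = dotTriple e p q s := by
  have : FiniteDimensional ℂ V := Module.Basis.finiteDimensional_of_finite e
  rw [← map_frame_three]
  exact (isImageCone_grassmannian (stdBasis 3)).coneTangentSpace_eq
    (injective_frame_three e hp hpq hqs hsn) (dotTriple_le_span_lineDirections e)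
    (chartDim_le_finrank_dotTriple e hp hpq hqs hsn)

theorem finrank_dotTriple : Module.finrank ℂ (dotTriple e p q s) = 3 * n - 8 := by
  have : FiniteDimensional ℂ V := Module.Basis.finiteDimensional_of_finite e
  have hle := (isImageCone_grassmannian
    (stdBasis 3)).finrank_le_chartDim_of_le_span_lineDirections
      (injective_frame_three e hp hpq hqs hsn) (dotTriple_le_span_lineDirections e)
  rw [hle.antisymm (chartDim_le_finrank_dotTriple e hp hpq hqs hsn), chartDim_fin_fun e,
    Nat.choose_self]
  omega

end Grassmannian

section RestrictedSecant

/-- The trivector `x₁x₂x₃ + x₁x₄x₅` on `ℂ⁵`. -/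
def meetingModel : ⋀[ℂ]^3 (Fin 5 → ℂ) :=
  wedge₃ (stdBasis 5 0) (stdBasis 5 1) (stdBasis 5 2) +
    wedge₃ (stdBasis 5 0) (stdBasis 5 3) (stdBasis 5 4)

theorem dotFive_le_span_lineDirections :
    dotFive e ≤ Submodule.span ℂ (lineDirections meetingModel (initialFrame e 5)) := by
  have h := dot_le_span_lineDirections_restrictedSecantPoints (g₀ := initialFrame e 5) (stdBasis 5)
  simp only [frame_stdBasis] at h
  exact h

theorem map_initialFrame_five : exteriorPower.map 3 (initialFrame e 5) meetingModel =
    e3 e 1 2 3 + e3 e 1 4 5 := by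
  simp only [meetingModel, map_add, map_wedge₃, frame_stdBasis]
  rfl

theorem finrank_extraSpan_le : Module.finrank ℂ (extraSpan e) ≤ n - 5 := by
  have hset : {x | ∃ i : ℕ, 6 ≤ i ∧ i ≤ n ∧ x = e3 e i 2 3 - e3 e i 4 5} =
      Set.range fun i : Fin (n - 5) ↦ e3 e (i + 6) 2 3 - e3 e (i + 6) 4 5 := by
    ext x
    constructor
    · rintro ⟨i, hi, hin, rfl⟩
      exact ⟨⟨i - 6, by omega⟩, by simp only [Nat.sub_add_cancel hi]⟩
    · rintro ⟨i, rfl⟩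
      exact ⟨i + 6, by omega, by omega, rfl⟩
  rw [extraSpan, hset]
  exact (finrank_range_le_card _).trans_eq (Fintype.card_fin _)

theorem span_range_meet :
    Submodule.span ℂ (Set.range ![e3 e 1 2 4, e3 e 1 2 5, e3 e 1 3 4, e3 e 1 3 5]) =
      meetSpan e := by
  simp only [Matrix.range_cons, Matrix.range_empty, Set.union_empty, Set.singleton_union]

variable (hn : 5 ≤ n)
include hn

theorem finrank_meetSpan : Module.finrank ℂ (meetSpan e) = 4 := by
  rw [← span_range_meet, finrank_span_eq_card (linearIndependent_meet e hn), Fintype.card_fin]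

theorem finrank_dotFive_le : Module.finrank ℂ (dotFive e) ≤ 5 * n - 15 := by
  have : FiniteDimensional ℂ V := Module.Basis.finiteDimensional_of_finite e
  have h := (isImageCone_restrictedSecantPoints
    (stdBasis 5)).finrank_le_chartDim_of_le_span_lineDirections
      (injective_initialFrame e hn) (dotFive_le_span_lineDirections e)
  rw [chartDim_fin_fun e, show Nat.choose 5 3 = 10 by decide] at h
  omega

theorem finrank_dotFive_add_finrank_extraSpan :
    Module.finrank ℂ (dotFive e) + Module.finrank ℂ (extraSpan e) =
      6 * n - 20 + Module.finrank ℂ (dotFive e ⊓ extraSpan e : Submodule ℂ (⋀[ℂ]^3 V)) := by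
  have : FiniteDimensional ℂ V := Module.Basis.finiteDimensional_of_finite e
  have h := Submodule.finrank_sup_add_finrank_inf_eq (dotTriple e 1 2 3) (dotTriple e 1 4 5)
  rw [dotTriple_sup_dotTriple, dotTriple_inf_dotTriple, finrank_meetSpan e hn,
    finrank_dotTriple e (by omega) (by omega) (by omega) (by omega),
    finrank_dotTriple e (by omega) (by omega) (by omega) hn] at h
  rw [← Submodule.finrank_sup_add_finrank_inf_eq]
  omega

theorem finrank_dotFive : Module.finrank ℂ (dotFive e) = 5 * n - 15 := by
  have hsum := finrank_dotFive_add_finrank_extraSpan e hn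
  have hfive := finrank_dotFive_le e hn
  have hextra := finrank_extraSpan_le e
  omega

theorem finrank_extraSpan : Module.finrank ℂ (extraSpan e) = n - 5 := by
  have hsum := finrank_dotFive_add_finrank_extraSpan e hn
  have hfive := finrank_dotFive_le e hn
  have hextra := finrank_extraSpan_le e
  omega

theorem dotFive_inf_extraSpan : dotFive e ⊓ extraSpan e = ⊥ := by
  have : FiniteDimensional ℂ V := Module.Basis.finiteDimensional_of_finite e
  have hsum := finrank_dotFive_add_finrank_extraSpan e hn
  rw [finrank_dotFive e hn, finrank_extraSpan e hn] at hsum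
  exact Submodule.finrank_eq_zero.mp (by omega)

theorem chartDim_le_finrank_dotFive :
    chartDim (Fin 5 → ℂ) V 3 ≤ Module.finrank ℂ (dotFive e) := by
  rw [chartDim_fin_fun e, finrank_dotFive e hn,
    show Nat.choose 5 3 = 10 by decide]
  omega

theorem coneTangentSpace_restrictedSecant :
    coneTangentSpace (restrictedSecant V 2 1 3) (e3 e 1 2 3 + e3 e 1 4 5) = dotFive e := by
  have : FiniteDimensional ℂ V := Module.Basis.finiteDimensional_of_finite e
  rw [← map_initialFrame_five]
  exact (isImageCone_restrictedSecantPoints (stdBasis 5)).coneTangentSpace_zariskiClosure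
    (injective_initialFrame e hn) (dotFive_le_span_lineDirections e)
    (chartDim_le_finrank_dotFive e hn)

include e in
theorem hasDim_restrictedSecant : HasDim (restrictedSecant V 2 1 3) (5 * n - 16) := by
  have : FiniteDimensional ℂ V := Module.Basis.finiteDimensional_of_finite e
  refine (isImageCone_restrictedSecantPoints (stdBasis 5)).hasDim_zariskiClosure
    (injective_initialFrame e hn) (dotFive_le_span_lineDirections e)
    (chartDim_le_finrank_dotFive e hn) ?_
  rw [finrank_dotFive e hn]
  omega

end RestrictedSecant

section SecantVariety

theorem nonempty_linearEquiv_prod_prod {W : Type*} [AddCommGroup W] [Module ℂ W]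
    [FiniteDimensional ℂ W] {A B C D : Submodule ℂ W}
    (h : Module.finrank ℂ A = Module.finrank ℂ B + (Module.finrank ℂ C + Module.finrank ℂ D)) :
    Nonempty (A ≃ₗ[ℂ] B × C × D) :=
  FiniteDimensional.nonempty_linearEquiv_of_finrank_eq
    (by rw [Module.finrank_prod, Module.finrank_prod, h])

/-- The trivector `x₁x₂x₃ + x₄x₅x₆` on `ℂ⁶`. -/
def disjointModel : ⋀[ℂ]^3 (Fin 6 → ℂ) :=
  wedge₃ (stdBasis 6 0) (stdBasis 6 1) (stdBasis 6 2) +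
    wedge₃ (stdBasis 6 3) (stdBasis 6 4) (stdBasis 6 5)

theorem dotSix_le_span_lineDirections :
    dotSix e ≤ Submodule.span ℂ (lineDirections disjointModel (initialFrame e 6)) := by
  have h := dot_le_span_lineDirections_secantPoints (g₀ := initialFrame e 6) (stdBasis 6)
  simp only [frame_stdBasis] at h
  exact h

theorem map_initialFrame_six : exteriorPower.map 3 (initialFrame e 6) disjointModel =
    e3 e 1 2 3 + e3 e 4 5 6 := by
  simp only [disjointModel, map_add, map_wedge₃, frame_stdBasis]
  rfl

variable (hn : 6 ≤ n)
include hn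

theorem finrank_dotSix : Module.finrank ℂ (dotSix e) = 6 * n - 16 := by
  have : FiniteDimensional ℂ V := Module.Basis.finiteDimensional_of_finite e
  have h := Submodule.finrank_sup_add_finrank_inf_eq (dotTriple e 1 2 3) (dotTriple e 4 5 6)
  rw [← dotSix_eq_sup, dotTriple_inf_eq_bot, finrank_bot,
    finrank_dotTriple e (by omega) (by omega) (by omega) (by omega),
    finrank_dotTriple e (by omega) (by omega) (by omega) hn] at h
  omega

theorem chartDim_le_finrank_dotSix :
    chartDim (Fin 6 → ℂ) V 3 ≤ Module.finrank ℂ (dotSix e) := by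
  rw [chartDim_fin_fun e, finrank_dotSix e hn, show Nat.choose 6 3 = 20 by decide]
  omega

theorem coneTangentSpace_secantVariety :
    coneTangentSpace (secantVariety 2 (grassmannian V 3)) (e3 e 1 2 3 + e3 e 4 5 6) =
      dotSix e := by
  have : FiniteDimensional ℂ V := Module.Basis.finiteDimensional_of_finite e
  rw [← map_initialFrame_six]
  exact (isImageCone_secantPoints (stdBasis 6)).coneTangentSpace_zariskiClosure
    (injective_initialFrame e hn) (dotSix_le_span_lineDirections e)
    (chartDim_le_finrank_dotSix e hn)

include e in
theorem hasDim_secantVariety :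
    HasDim (secantVariety 2 (grassmannian V 3)) (6 * n - 17) := by
  have : FiniteDimensional ℂ V := Module.Basis.finiteDimensional_of_finite e
  refine (isImageCone_secantPoints (stdBasis 6)).hasDim_zariskiClosure
    (injective_initialFrame e hn) (dotSix_le_span_lineDirections e)
    (chartDim_le_finrank_dotSix e hn) ?_
  rw [finrank_dotSix e hn]
  omega

include e in
theorem hasCodimIn_restrictedSecant :
    HasCodimIn (restrictedSecant V 2 1 3) (secantVariety 2 (grassmannian V 3)) (n - 1) := by
  refine ⟨restrictedSecant_subset_secantVariety, 5 * n - 16,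
    hasDim_restrictedSecant e (by omega), ?_⟩
  rw [show 5 * n - 16 + (n - 1) = 6 * n - 17 by omega]
  exact hasDim_secantVariety e hn

theorem nonempty_linearEquiv_dotSix :
    Nonempty (dotSix e ≃ₗ[ℂ] dotFive e × extraSpan e × meetSpan e) := by
  have : FiniteDimensional ℂ V := Module.Basis.finiteDimensional_of_finite e
  refine nonempty_linearEquiv_prod_prod ?_
  rw [finrank_dotSix e hn, finrank_dotFive e (by omega), finrank_extraSpan e (by omega),
    finrank_meetSpan e (by omega)]
  omega

end SecantVariety

end Frames

end RestrictedSecant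

end

open RestrictedSecant in
theorem mainTheorem3 {V : Type*} [AddCommGroup V] [Module ℂ V] (n : ℕ) (hn : 5 ≤ n)
    (e : Module.Basis (Fin n) ℂ V) :
    -- the tangent space of the restricted chordal variety
    coneTangentSpace (restrictedSecant V 2 1 3) (e3 e 1 2 3 + e3 e 1 4 5) =
      (dot {e2 e 2 3 + e2 e 4 5, e2 e 1 2, e2 e 1 3, e2 e 1 4, e2 e 1 5} : Set (⋀[ℂ]^3 V)) ∧
    -- the tangent spaces of the Grassmannian at `e₁e₂e₃` and `e₁e₄e₅`, and their intersection
    coneTangentSpace (grassmannian V 3) (e3 e 1 2 3) =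
      (dot {e2 e 1 2, e2 e 1 3, e2 e 2 3} : Set (⋀[ℂ]^3 V)) ∧
    coneTangentSpace (grassmannian V 3) (e3 e 1 4 5) =
      (dot {e2 e 1 4, e2 e 1 5, e2 e 4 5} : Set (⋀[ℂ]^3 V)) ∧
    coneTangentSpace (grassmannian V 3) (e3 e 1 2 3) ∩ coneTangentSpace (grassmannian V 3) (e3 e 1 4 5) =
      (Submodule.span ℂ {e3 e 1 2 4, e3 e 1 2 5, e3 e 1 3 4, e3 e 1 3 5} : Set (⋀[ℂ]^3 V)) ∧
    LinearIndependent ℂ ![e3 e 1 2 4, e3 e 1 2 5, e3 e 1 3 4, e3 e 1 3 5] ∧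
    -- the sum of these two tangent spaces, as an internal direct sum
    coneTangentSpace (grassmannian V 3) (e3 e 1 2 3) + coneTangentSpace (grassmannian V 3) (e3 e 1 4 5) =
      coneTangentSpace (restrictedSecant V 2 1 3) (e3 e 1 2 3 + e3 e 1 4 5) +
        (extraSpan e : Set (⋀[ℂ]^3 V)) ∧
    coneTangentSpace (restrictedSecant V 2 1 3) (e3 e 1 2 3 + e3 e 1 4 5) ∩
        (extraSpan e : Set (⋀[ℂ]^3 V)) = {0} ∧
    Module.finrank ℂ (extraSpan e) = n - 5 ∧
    -- the tangent space of the chordal variety, and the comparison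
    (6 ≤ n →
      coneTangentSpace (secantVariety 2 (grassmannian V 3)) (e3 e 1 2 3 + e3 e 4 5 6) =
        (dot {e2 e 1 2, e2 e 1 3, e2 e 2 3, e2 e 4 5, e2 e 4 6, e2 e 5 6} :
          Set (⋀[ℂ]^3 V)) ∧
      coneTangentSpace (secantVariety 2 (grassmannian V 3)) (e3 e 1 2 3 + e3 e 4 5 6) =
        coneTangentSpace (grassmannian V 3) (e3 e 1 2 3) +
          coneTangentSpace (grassmannian V 3) (e3 e 4 5 6) ∧
      coneTangentSpace (grassmannian V 3) (e3 e 1 2 3) ∩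
        coneTangentSpace (grassmannian V 3) (e3 e 4 5 6) = {0} ∧
      Nonempty (
        Submodule.span ℂ
          (coneTangentSpace (secantVariety 2 (grassmannian V 3)) (e3 e 1 2 3 + e3 e 4 5 6)) ≃ₗ[ℂ]
        (Submodule.span ℂ
            (coneTangentSpace (restrictedSecant V 2 1 3) (e3 e 1 2 3 + e3 e 1 4 5)) ×
          extraSpan e ×
          Submodule.span ℂ
            (coneTangentSpace (grassmannian V 3) (e3 e 1 2 3) ∩
              coneTangentSpace (grassmannian V 3) (e3 e 1 4 5))))) ∧
    -- dimension and codimension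
    HasDim (restrictedSecant V 2 1 3) (5 * n - 16) ∧
    (6 ≤ n →
      HasCodimIn (restrictedSecant V 2 1 3) (secantVariety 2 (grassmannian V 3)) (n - 1)) ∧
    (n = 5 → restrictedSecant V 2 1 3 = secantVariety 2 (grassmannian V 3)) := by
  have hF := coneTangentSpace_restrictedSecant e hn
  have h₁₂₃ := coneTangentSpace_grassmannian e le_rfl one_lt_two (by omega : 2 < 3) (by omega)
  have h₁₄₅ := coneTangentSpace_grassmannian e le_rfl (by omega : 1 < 4) (by omega : 4 < 5) hn
  have hmeet : coneTangentSpace (grassmannian V 3) (e3 e 1 2 3) ∩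
      coneTangentSpace (grassmannian V 3) (e3 e 1 4 5) = meetSpan e := by
    rw [h₁₂₃, h₁₄₅, ← Submodule.coe_inf, dotTriple_inf_dotTriple]
  refine ⟨hF, h₁₂₃, h₁₄₅, hmeet, linearIndependent_meet e hn, ?_, ?_, finrank_extraSpan e hn,
    fun hn6 ↦ ?_, hasDim_restrictedSecant e hn, hasCodimIn_restrictedSecant e, fun hn5 ↦ ?_⟩
  · rw [h₁₂₃, h₁₄₅, hF, ← Submodule.coe_sup, ← Submodule.coe_sup, dotTriple_sup_dotTriple]
  · rw [hF, ← Submodule.coe_inf, dotFive_inf_extraSpan e hn, Submodule.bot_coe]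
  · have h₄₅₆ := coneTangentSpace_grassmannian e (by omega : 1 ≤ 4) (by omega : 4 < 5)
      (by omega : 5 < 6) hn6
    have hS := coneTangentSpace_secantVariety e hn6
    refine ⟨hS, ?_, ?_, ?_⟩
    · rw [h₁₂₃, h₄₅₆, hS, ← Submodule.coe_sup, dotSix_eq_sup]
    · rw [h₁₂₃, h₄₅₆, ← Submodule.coe_inf, dotTriple_inf_eq_bot, Submodule.bot_coe]
    · rw [hmeet, hS, hF, Submodule.span_eq, Submodule.span_eq, Submodule.span_eq]
      exact nonempty_linearEquiv_dotSix e hn6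
  · have : FiniteDimensional ℂ V := Module.Basis.finiteDimensional_of_finite e
    refine restrictedSecant_two_eq_secantVariety (k := 1) ?_
    rw [Module.finrank_eq_card_basis e, Fintype.card_fin, hn5]
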